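/- Let two users have channel gains $X_1,X_2$ that are i.i.d. uniform on $[0,1]$, and let $Y_1=\min(X_1,X_2)$, $Y_2=\max(X_1,X_2)$. *Delay.* In every minislot a strategy selects, as a function of the feedback received in the earlier minislots, a contention range $(a,b]$; the users with gain in $(a,b]$ transmit, and the feedback is $0$, $1$ or $e$ according to whether no user, exactly one user, or both users transmit. Contention ends with the first feedback $1$; the delay is the number of minislots used, the last one included ($\infty$ if feedback $1$ never occurs). A maximal probability allocation (MPA) strategy is one which, after every feedback history without a $1$, uses a range that maximizes, among all ranges, the conditional probability (given that history) that the user with the highest gain is the only one to transmit. The opportunistic splitting algorithm for two users starts with the range $(\tfrac12,1]$ and, when both gains are known to lie in an interval with endpoints $l<u$, uses the range $(\tfrac{l+u}2,u]$. Then this algorithm is an MPA strategy; for every MPA strategy, almost surely a feedback $1$ occurs and the lone transmitter at the first such feedback is the user with the highest gain; every MPA strategy has expected delay $2$; and every strategy has expected delay at least $2$. *Entropy.* A code is a measurable map $C$ that assigns to every pair $0\le y_1<y_2\le 1$ a threshold $C(y_1,y_2)$ with $y_1\le C(y_1,y_2)<y_2$ and for which $Y=C(Y_1,Y_2)$ has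 a discrete distribution; its entropy is $-\sum_y \Pr(Y=y)\log_2\Pr(Y=y)\in[0,\infty]$. A sequence of MPA thresholds is a sequence $(t_k)_{k\ge1}$ in $[0,1]$ such that, for every $k$, $t=t_k$ maximizes over $t\in[0,1]$ the conditional probability of $Y_1\le t<Y_2$ given that none of $t_1,\dots,t_{k-1}$ lies in $[Y_1,Y_2)$. Its code assigns to $(y_1,y_2)$ the first $t_k$ with $y_1\le t_k<y_2$. Then the dyadic sequence $\tfrac12,\tfrac34,\tfrac14,\tfrac78,\tfrac58,\tfrac38,\tfrac18,\dots$ is a sequence of MPA thresholds, and every sequence of MPA thresholds has the same set of terms as this one; the code of every sequence of MPA thresholds is a code in the above sense, with entropy exactly $3$ bits; and every code has entropy at least $3$ bits. Finally, the two descriptions agree: for every MPA strategy and every sequence of MPA thresholds, almost surely the lower endpoint $a$ of the range $(a,b]$ used in the minislot of the first feedback $1$ equals the threshold that the code assigns to $(Y_1,Y_2)$. -/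

import Mathlib

open MeasureTheory ProbabilityTheory
open scoped ENNReal

noncomputable section

namespace Contention

/-- Ternary feedback of the base station at the end of a minislot:
`idle` is `0` (no transmission), `success` is `1` (exactly one), `collision` is `e`. -/
inductive Feedback where
  | idle
  | success
  | collision

/-- A contention range `(r.1, r.2]`: the users whose gain falls in it transmit. -/
abbrev Range : Type := ℝ × ℝ

/-- A strategy picks the contention range of the next minislot from the feedback received
in the previous minislots (oldest first). -/
abbrev Strategy : Type := List Feedback → Range

open Classical in
/-- Feedback of a minislot with contention range `r`, for two users with gains `x 0`, `x 1`. -/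
def feedback (r : Range) (x : Fin 2 → ℝ) : Feedback :=
  match (Finset.univ.filter fun i => x i ∈ Set.Ioc r.1 r.2).card with
  | 0 => .idle
  | 1 => .success
  | _ => .collision

/-- The feedback of the first `n` minislots. (What happens after the first `success`, when
contention is over, plays no role below.) -/
def history (σ : Strategy) (x : Fin 2 → ℝ) : ℕ → List Feedback
  | 0 => []
  | n + 1 => history σ x n ++ [feedback (σ (history σ x n)) x]

/-- The range `r` identifies the best user: exactly one user transmits, and it is the one with
the (strictly) highest gain. -/
def IdentifiesBest (r : Range) (x : Fin 2 → ℝ) : Prop :=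
  ∃ i, x i ∈ Set.Ioc r.1 r.2 ∧ ∀ j, j ≠ i → x j ∉ Set.Ioc r.1 r.2 ∧ x j < x i

/-- The first minislot with feedback `success` is the one with index `n` (counted from `0`). -/
def FirstSuccess (σ : Strategy) (x : Fin 2 → ℝ) (n : ℕ) : Prop :=
  feedback (σ (history σ x n)) x = .success ∧
    ∀ m < n, feedback (σ (history σ x m)) x ≠ .success

/-- The number of minislots used up to and including the first `success`
(`∞` if there is none). -/
def delay (σ : Strategy) (x : Fin 2 → ℝ) : ℝ≥0∞ :=
  ⨅ (n : ℕ) (_ : FirstSuccess σ x n), ((n : ℝ≥0∞) + 1)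

/-- The ordered gains `Y₁ ≤ Y₂`. -/
def ordered (x : Fin 2 → ℝ) : ℝ × ℝ := (min (x 0) (x 1), max (x 0) (x 1))

/-- `t` separates the ordered pair `q`: `q.1 ≤ t < q.2`. -/
def Separates (t : ℝ) (q : ℝ × ℝ) : Prop := q.1 ≤ t ∧ t < q.2

/-- State of the opportunistic splitting algorithm. -/
structure OSAState where
  low : ℝ
  min : ℝ
  max : ℝ

open Classical in
/-- One update of the opportunistic splitting algorithm for `N` users. -/
def osaStep (N : ℕ) (s : OSAState) : Feedback → OSAState
  | .collision => ⟨s.min, (s.min + s.max) / 2, s.max⟩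
  | .idle =>
      if s.low ≠ 0 then ⟨s.low, (s.low + s.min) / 2, s.min⟩
      else ⟨s.low, s.min * (1 - 1 / N), s.min⟩
  | .success => s

/-- The opportunistic splitting algorithm for `N` users, as a strategy. -/
def osa (N : ℕ) : Strategy := fun h =>
  let s := h.foldl (osaStep N) ⟨0, 1 - 1 / N, 1⟩
  (s.min, s.max)

section Random

variable {Ω : Type*} [MeasurableSpace Ω]

/-- Expected number of minislots needed to resolve contention. -/
def expectedDelay (P : Measure Ω) (X : Fin 2 → Ω → ℝ) (σ : Strategy) : ℝ≥0∞ :=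
  ∫⁻ ω, delay σ (fun i => X i ω) ∂P

/-- Maximal probability allocation as a strategy: as long as contention is unresolved, the next
range maximizes, among all ranges, the conditional probability of identifying the best user,
given the feedback received so far. -/
def IsMPAStrategy (P : Measure Ω) (X : Fin 2 → Ω → ℝ) (σ : Strategy) : Prop :=
  ∀ h : List Feedback, Feedback.success ∉ h → ∀ r : Range,
    P[|{ω | history σ (fun i => X i ω) h.length = h}] {ω | IdentifiesBest r (fun i => X i ω)} ≤
    P[|{ω | history σ (fun i => X i ω) h.length = h}] {ω | IdentifiesBest (σ h) (fun i => X i ω)}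

/-- The event that `(Y₁, Y₂)` is separated by none of `y 0, …, y (k - 1)`. -/
def unresolved (X : Fin 2 → Ω → ℝ) (y : ℕ → ℝ) (k : ℕ) : Set Ω :=
  {ω | ∀ j < k, ¬ Separates (y j) (ordered fun i => X i ω)}

/-- Maximal probability allocation as a list of thresholds: `y k` maximizes over `[0,1]` the
conditional probability of separating `(Y₁, Y₂)`, given that no earlier threshold does. -/
def IsMPAThresholds (P : Measure Ω) (X : Fin 2 → Ω → ℝ) (y : ℕ → ℝ) : Prop :=
  ∀ k, y k ∈ Set.Icc (0 : ℝ) 1 ∧ ∀ t ∈ Set.Icc (0 : ℝ) 1,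
    P[|unresolved X y k] {ω | Separates t (ordered fun i => X i ω)} ≤
    P[|unresolved X y k] {ω | Separates (y k) (ordered fun i => X i ω)}

/-- The threshold random variable `Y = C(Y₁, Y₂)` of a code `C`. -/
def threshold (X : Fin 2 → Ω → ℝ) (C : ℝ × ℝ → ℝ) (ω : Ω) : ℝ := C (ordered fun i => X i ω)

/-- A code: a measurable assignment of a separating threshold to every pair
`0 ≤ y₁ < y₂ ≤ 1`, whose threshold random variable is discrete. (Values at other arguments
are irrelevant; pairs with `y₁ = y₂` have no separating threshold and probability zero.) -/
structure IsCode (P : Measure Ω) (X : Fin 2 → Ω → ℝ) (C : ℝ × ℝ → ℝ) : Prop where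
  measurable : Measurable C
  separates : ∀ y₁ y₂ : ℝ, 0 ≤ y₁ → y₁ < y₂ → y₂ ≤ 1 → Separates (C (y₁, y₂)) (y₁, y₂)
  discrete : ∃ S : Set ℝ, S.Countable ∧ ∀ᵐ ω ∂P, threshold X C ω ∈ S

/-- Entropy, in bits, of a discrete real random variable; it may be `∞`. -/
def entropyBits (P : Measure Ω) (Y : Ω → ℝ) : ℝ≥0∞ :=
  ∑' y : ℝ, ENNReal.ofReal (-(P.real (Y ⁻¹' {y}) * Real.logb 2 (P.real (Y ⁻¹' {y}))))

end Random

open Classical in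
/-- The code of a list of thresholds: every pair gets the first threshold that separates it
(and the default `0` if there is none). -/
def firstThresholdCode (y : ℕ → ℝ) (q : ℝ × ℝ) : ℝ :=
  if h : ∃ k, Separates (y k) q then y (Nat.find h) else 0

/-- The dyadic thresholds `1/2, 3/4, 1/4, 7/8, 5/8, 3/8, 1/8, …`. -/
def dyadicThreshold (k : ℕ) : ℝ :=
  (2 * (2 ^ (Nat.log 2 (k + 1) + 1) - ((k : ℝ) + 1)) - 1) / 2 ^ (Nat.log 2 (k + 1) + 1)

end Contention

end

/-!
Given that both gains lie in `(l, u]`, a threshold `t` separates them with probability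
`2 (t - l) (u - t) / (u - l) ^ 2`, which is maximal exactly at the midpoint. So a maximal
probability allocation strategy bisects dyadic intervals, each minislot succeeds with conditional
probability `1 / 2`, and the delay is geometric with mean `2`. In the same way, maximal probability
allocation thresholds enumerate the midpoints of the dyadic intervals level by level.

For the lower bound on the delay, feedback during `n` minislots without a success depends on each
user only through the word that records whether it transmits, and contention is unresolved as long
as the two words agree. There are `2 ^ n` words, so by Cauchy–Schwarz two independent users agree
with probability at least `2 ^ (-n)`; summing over `n` gives `2`.

For the lower bound on the entropy, cut the square of gain pairs at the most likely threshold `t`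
into two smaller squares, where only thresholds on one side of `t` occur, and the region separated
by `t`. The log-sum inequality together with `h(s) ≥ 4 s (1 - s)` bits for the binary entropy `h`
shows that a lower bound of the form `(u - l) ^ 2 * (3 - log₂ Pr(l < Y < u))` for the contribution
of a square is preserved by this cut. On the unit square it is at least `3`.
-/

noncomputable section

namespace Contention

/-! ### Entropy inequalities -/

open Real in
lemma hasSum_log_two_sub_binEntropy {s : ℝ} (hs : |s| < 1) :
    HasSum (fun k : ℕ => s ^ (2 * (k + 1)) / ((2 * k + 2) * (2 * k + 1)))
      (log 2 - binEntropy ((1 + s) / 2)) := by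
  obtain ⟨hs₁, hs₂⟩ := abs_lt.1 hs
  have hodd := hasSum_log_sub_log_of_abs_lt_one hs
  have hsq : HasSum (fun k : ℕ => (s ^ 2) ^ (k + 1) / ((k : ℝ) + 1)) (-log (1 - s ^ 2)) :=
    hasSum_pow_div_log_of_abs_lt_one <| by
      rw [abs_pow]
      exact pow_lt_one₀ (abs_nonneg s) hs two_ne_zero
  have hterm (k : ℕ) : s ^ (2 * (k + 1)) / ((2 * k + 2) * (2 * k + 1)) =
      s / 2 * (2 * (1 / (2 * k + 1)) * s ^ (2 * k + 1)) -
        1 / 2 * ((s ^ 2) ^ (k + 1) / ((k : ℝ) + 1)) := by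
    rw [← pow_mul]
    field_simp
    ring
  have hvalue : log 2 - binEntropy ((1 + s) / 2) =
      s / 2 * (log (1 + s) - log (1 - s)) - 1 / 2 * -log (1 - s ^ 2) := by
    rw [show 1 - s ^ 2 = (1 + s) * (1 - s) by ring, log_mul (by linarith) (by linarith),
      binEntropy_eq_negMulLog_add_negMulLog_one_sub, negMulLog, negMulLog,
      show 1 - (1 + s) / 2 = (1 - s) / 2 by ring, log_div (by linarith) two_ne_zero,
      log_div (by linarith) two_ne_zero]
    ring
  simp only [hvalue, hterm]
  exact (hodd.mul_left _).sub (hsq.mul_left _)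

-- The power series of `log 2 - binEntropy ((1 + s) / 2)` in `s ^ 2` has nonnegative coefficients
-- and no constant term, so its quotient by `s ^ 2` is monotone.
open Real in
lemma sq_mul_log_two_sub_binEntropy_le {s r : ℝ} (hs : 0 ≤ s) (hsr : s ≤ r) (hr : r < 1) :
    r ^ 2 * (log 2 - binEntropy ((1 + s) / 2)) ≤ s ^ 2 * (log 2 - binEntropy ((1 + r) / 2)) := by
  have hr₀ : 0 ≤ r := hs.trans hsr
  have sum_of_lt {x : ℝ} (h₀ : 0 ≤ x) (h₁ : x < 1) :=
    hasSum_log_two_sub_binEntropy ((abs_of_nonneg h₀).trans_lt h₁)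
  refine hasSum_le (fun k => ?_) ((sum_of_lt hs (hsr.trans_lt hr)).mul_left _)
    ((sum_of_lt hr₀ hr).mul_left _)
  calc r ^ 2 * (s ^ (2 * (k + 1)) / ((2 * k + 2) * (2 * k + 1)))
      = (r * s) ^ 2 * (s ^ (2 * k) / ((2 * k + 2) * (2 * k + 1))) := by ring
    _ ≤ (r * s) ^ 2 * (r ^ (2 * k) / ((2 * k + 2) * (2 * k + 1))) := by gcongr
    _ = s ^ 2 * (r ^ (2 * (k + 1)) / ((2 * k + 2) * (2 * k + 1))) := by ring

open Real in
lemma four_mul_log_two_mul_le_binEntropy {t : ℝ} (ht : t ∈ Set.Icc (0 : ℝ) 1) :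
    4 * log 2 * (t * (1 - t)) ≤ binEntropy t := by
  wlog h : 1 / 2 ≤ t generalizing t
  · have := this (t := 1 - t) ⟨by linarith [ht.2], by linarith [ht.1]⟩ (by linarith)
    rwa [binEntropy_one_sub, sub_sub_cancel, mul_comm (1 - t)] at this
  rcases ht.2.eq_or_lt with rfl | ht₁
  · simp
  -- Let `r → 1` in the previous comparison, where `(1 + s) / 2 = t`.
  have hlim : (2 * t - 1) ∈ Set.Iio (1 : ℝ) := by simp only [Set.mem_Iio]; linarith
  have hle : ∀ᶠ r in nhdsWithin 1 (Set.Iio (1 : ℝ)),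
      r ^ 2 * (log 2 - binEntropy ((1 + (2 * t - 1)) / 2)) ≤
        (2 * t - 1) ^ 2 * (log 2 - binEntropy ((1 + r) / 2)) := by
    filter_upwards [Ioo_mem_nhdsLT hlim] with r hr
    exact sq_mul_log_two_sub_binEntropy_le (by linarith) hr.1.le hr.2
  have hcont : ∀ f : ℝ → ℝ, Continuous f → Filter.Tendsto f
      (nhdsWithin 1 (Set.Iio 1)) (nhds (f 1)) :=
    fun f hf => (hf.tendsto 1).mono_left nhdsWithin_le_nhds
  have key := le_of_tendsto_of_tendsto (hcont _ (by fun_prop)) (hcont _ (by fun_prop)) hle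
  rw [show (1 + (2 * t - 1)) / 2 = t by ring, show (1 + 1 : ℝ) / 2 = 1 by norm_num,
    binEntropy_one] at key
  linarith

lemma sum_mul_log_div_le {ι : Type*} {s : Finset ι} (hs : s.Nonempty) {w x : ι → ℝ}
    (hw : ∀ i ∈ s, 0 < w i) (hx : ∀ i ∈ s, 0 < x i) :
    ∑ i ∈ s, w i * Real.log (x i / w i) ≤
      (∑ i ∈ s, w i) * Real.log ((∑ i ∈ s, x i) / ∑ i ∈ s, w i) := by
  have hpos : 0 < ∑ i ∈ s, w i := Finset.sum_pos hw hs
  have jensen := strictConcaveOn_log_Ioi.concaveOn.le_map_centerMass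
    (fun i hi => (hw i hi).le) hpos (fun i hi => div_pos (hx i hi) (hw i hi))
  have hcancel : ∑ i ∈ s, w i * (x i / w i) = ∑ i ∈ s, x i :=
    Finset.sum_congr rfl fun i hi => mul_div_cancel₀ _ (hw i hi).ne'
  simp only [Finset.centerMass, smul_eq_mul, Function.comp_apply, hcancel] at jensen
  rwa [inv_mul_le_iff₀ hpos, inv_mul_eq_div] at jensen

lemma four_mul_log_two_mul_le {a b : ℝ} (ha : 0 < a) (hb : 0 < b) :
    4 * Real.log 2 * (a * b) ≤
      (a + b) * ((a + b) * Real.log (a + b) - a * Real.log a - b * Real.log b) := by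
  have hab : 0 < a + b := add_pos ha hb
  have hcompl : 1 - a / (a + b) = b / (a + b) := by field_simp; ring
  have hent := four_mul_log_two_mul_le_binEntropy (t := a / (a + b))
    ⟨by positivity, (div_le_one hab).2 (by linarith)⟩
  rw [Real.binEntropy, hcompl, Real.log_inv, Real.log_inv, Real.log_div ha.ne' hab.ne',
    Real.log_div hb.ne' hab.ne'] at hent
  have hscale := mul_le_mul_of_nonneg_left hent (sq_nonneg (a + b))
  field_simp at hscale
  linarith

lemma log_split_le {a b p ma mb m : ℝ} (ha : 0 < a) (hb : 0 < b) (hp : 0 < p) (hma : 0 < ma)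
    (hmb : 0 < mb) (hm : p + ma + mb ≤ m) :
    2 * (a * b) * Real.log p + a ^ 2 * Real.log ma + b ^ 2 * Real.log mb ≤
      (a + b) ^ 2 * Real.log m - 6 * Real.log 2 * (a * b) := by
  have logsum := sum_mul_log_div_le (s := Finset.univ) Finset.univ_nonempty
    (w := ![2 * (a * b), a ^ 2, b ^ 2]) (x := ![p, ma, mb])
    (fun | 0, _ => mul_pos two_pos (mul_pos ha hb) | 1, _ => pow_pos ha 2 | 2, _ => pow_pos hb 2)
    (fun | 0, _ => hp | 1, _ => hma | 2, _ => hmb)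
  simp only [Fin.sum_univ_three, Matrix.cons_val] at logsum
  have hmono : Real.log (p + ma + mb) ≤ Real.log m := Real.log_le_log (by positivity) hm
  rw [show 2 * (a * b) + a ^ 2 + b ^ 2 = (a + b) ^ 2 by ring,
    Real.log_div (by positivity) (by positivity), Real.log_div (by positivity) (by positivity),
    Real.log_div (by positivity) (by positivity), Real.log_div (by positivity) (by positivity),
    Real.log_mul (by positivity) (by positivity), Real.log_mul (by positivity) (by positivity),
    Real.log_pow, Real.log_pow, Real.log_pow] at logsum
  push_cast at logsum
  linarith [four_mul_log_two_mul_le ha hb, mul_le_mul_of_nonneg_left hmono (sq_nonneg (a + b))]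

lemma logb_split_le {a b p ma mb m : ℝ} (ha : 0 < a) (hb : 0 < b) (hp : 0 < p) (hma : 0 < ma)
    (hmb : 0 < mb) (hm : p + ma + mb ≤ m) :
    2 * (a * b) * Real.logb 2 p + a ^ 2 * Real.logb 2 ma + b ^ 2 * Real.logb 2 mb ≤
      (a + b) ^ 2 * Real.logb 2 m - 6 * (a * b) := by
  have hlog2 : 0 < Real.log 2 := Real.log_pos one_lt_two
  have hlogb (x : ℝ) : Real.log x = Real.log 2 * Real.logb 2 x := by
    rw [Real.logb, mul_div_cancel₀ _ hlog2.ne']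
  have hlog := log_split_le ha hb hp hma hmb hm
  rw [hlogb p, hlogb ma, hlogb mb, hlogb m] at hlog
  exact le_of_mul_le_mul_left (by linarith) hlog2

/-! ### Series and probability -/

lemma tsum_comp_log_succ (f : ℕ → ℝ≥0∞) :
    ∑' k, f (Nat.log 2 (k + 1)) = ∑' n, 2 ^ n * f n := by
  rw [← ENNReal.tsum_fiberwise _ fun k => Nat.log 2 (k + 1)]
  refine tsum_congr fun n => ?_
  have hfiber :
      (fun k => Nat.log 2 (k + 1)) ⁻¹' {n} = Finset.Ico (2 ^ n - 1) (2 ^ (n + 1) - 1) := by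
    ext k
    simp only [Set.mem_preimage, Set.mem_singleton_iff, Finset.coe_Ico, Set.mem_Ico,
      Nat.log_eq_iff (Or.inr ⟨one_lt_two, k.succ_ne_zero⟩)]
    omega
  calc ∑' k : ↥((fun k => Nat.log 2 (k + 1)) ⁻¹' {n}), f (Nat.log 2 (k + 1))
      = ∑' _ : ↥((fun k => Nat.log 2 (k + 1)) ⁻¹' {n}), f n := tsum_congr fun k => congrArg f k.2
    _ = 2 ^ n * f n := by
      rw [hfiber, Finset.tsum_subtype' _ fun _ => f n, Finset.sum_const, Nat.card_Ico,
        nsmul_eq_mul, pow_succ, show 2 ^ n * 2 - 1 - (2 ^ n - 1) = 2 ^ n by omega]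
      push_cast
      rfl

lemma tsum_odd_mul_inv_two_pow :
    ∑' n : ℕ, (2 : ℝ≥0∞) ^ n * ENNReal.ofReal ((2 * n + 1) / 2 ^ (2 * n + 1)) = 3 := by
  have hsum : HasSum (fun n : ℕ => (n : ℝ) * (1 / 2) ^ n + 1 / 2 * (1 / 2) ^ n) 3 := by
    have h := (hasSum_coe_mul_geometric_of_norm_lt_one (r := (1 / 2 : ℝ)) (by norm_num)).add
      (hasSum_geometric_two.mul_left (1 / 2))
    rwa [show (1 / 2 : ℝ) / (1 - 1 / 2) ^ 2 + 1 / 2 * 2 = 3 by norm_num] at h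
  have hterm (n : ℕ) : (2 : ℝ≥0∞) ^ n * ENNReal.ofReal ((2 * n + 1) / 2 ^ (2 * n + 1)) =
      ENNReal.ofReal (n * (1 / 2) ^ n + 1 / 2 * (1 / 2) ^ n) := by
    rw [← ENNReal.ofReal_ofNat 2, ← ENNReal.ofReal_pow zero_le_two,
      ← ENNReal.ofReal_mul (by positivity)]
    congr 1
    rw [one_div_pow]
    field_simp
    ring
  simp only [hterm]
  rw [← ENNReal.ofReal_tsum_of_nonneg (fun n => by positivity) hsum.summable, hsum.tsum_eq,
    ENNReal.ofReal_ofNat]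

section Probability

variable {Ω : Type*} [MeasurableSpace Ω] {P : Measure Ω}

lemma cond_congr_ae {E F : Set Ω} (h : E =ᵐ[P] F) : P[|E] = P[|F] := by
  rw [ProbabilityTheory.cond, ProbabilityTheory.cond, Measure.restrict_congr_set h, measure_congr h]

lemma cond_le_cond_iff [IsFiniteMeasure P] {E A B : Set Ω} (hE : P E ≠ 0)
    (hA : MeasurableSet A) (hB : MeasurableSet B) :
    P[|E] A ≤ P[|E] B ↔ P.real (E ∩ A) ≤ P.real (E ∩ B) := by
  rw [cond_apply' hA, cond_apply' hB, ENNReal.mul_le_mul_iff_right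
    (ENNReal.inv_ne_zero.2 (measure_ne_top P E)) (ENNReal.inv_ne_top.2 hE), Measure.real,
    Measure.real, ENNReal.toReal_le_toReal (measure_ne_top _ _) (measure_ne_top _ _)]

-- Cauchy–Schwarz: the squares of the at most `#s` point masses sum to at least `1 / #s`.
lemma inv_card_le_prob_eq [IsProbabilityMeasure P] {β : Type*} [MeasurableSpace β]
    [MeasurableSingletonClass β] {U V : Ω → β} (hU : Measurable U) (hV : Measurable V)
    (hindep : IndepFun U V P) (hident : IdentDistrib U V P P) {s : Finset β}
    (hs : ∀ ω, U ω ∈ s) : (s.card : ℝ)⁻¹ ≤ P.real {ω | U ω = V ω} := by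
  set p : β → ℝ := fun b => P.real (U ⁻¹' {b})
  have hsum : ∑ b ∈ s, p b = 1 := by
    rw [sum_measureReal_preimage_singleton s fun b _ => hU (measurableSet_singleton b),
      Set.preimage_eq_univ_iff.2 (by rintro _ ⟨ω, rfl⟩; exact hs ω), probReal_univ]
  have hjoint (b : β) : p b ^ 2 = P.real (U ⁻¹' {b} ∩ V ⁻¹' {b}) := by
    simp only [p, Measure.real]
    rw [hindep.measure_inter_preimage_eq_mul _ _ (measurableSet_singleton b)
      (measurableSet_singleton b), ENNReal.toReal_mul,
      ← hident.measure_mem_eq (measurableSet_singleton b), sq]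
  have hmeas (b : β) : MeasurableSet (U ⁻¹' {b} ∩ V ⁻¹' {b}) :=
    (hU (measurableSet_singleton b)).inter (hV (measurableSet_singleton b))
  have hdisj : (s : Set β).PairwiseDisjoint fun b => U ⁻¹' {b} ∩ V ⁻¹' {b} := fun b _ c _ hbc =>
    Set.disjoint_left.2 fun ω hb hc => hbc (hb.1.symm.trans hc.1)
  have hcard : 0 < (s.card : ℝ) := by
    obtain ⟨ω⟩ := nonempty_of_isProbabilityMeasure P
    exact_mod_cast Finset.card_pos.2 ⟨_, hs ω⟩
  calc (s.card : ℝ)⁻¹ ≤ ∑ b ∈ s, p b ^ 2 := by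
        rw [inv_le_iff_one_le_mul₀' hcard]
        simpa only [hsum, one_pow] using sq_sum_le_card_mul_sum_sq (s := s) (f := p)
    _ = P.real (⋃ b ∈ s, U ⁻¹' {b} ∩ V ⁻¹' {b}) := by
        rw [measureReal_biUnion_finset hdisj fun b _ => hmeas b]
        exact Finset.sum_congr rfl fun b _ => hjoint b
    _ ≤ P.real {ω | U ω = V ω} := measureReal_mono <| Set.iUnion₂_subset fun b _ ω hω =>
        hω.1.trans hω.2.symm

end Probability

/-! ### Dyadic enumerations -/

/-- The dyadic fraction `i / 2 ^ n`. The cells of level `n` are the intervals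
`(dyadic n i, dyadic n (i + 1)]` with `i < 2 ^ n`. -/
def dyadic (n i : ℕ) : ℝ := i / 2 ^ n

lemma dyadic_strictMono (n : ℕ) : StrictMono (dyadic n) := fun i j hij => by
  unfold dyadic
  gcongr

@[simp] lemma dyadic_zero_right (n : ℕ) : dyadic n 0 = 0 := by simp [dyadic]

@[simp] lemma dyadic_two_pow (n : ℕ) : dyadic n (2 ^ n) = 1 := by simp [dyadic]

lemma dyadic_nonneg (n i : ℕ) : 0 ≤ dyadic n i := by unfold dyadic; positivity

lemma dyadic_le_one {n i : ℕ} (hi : i ≤ 2 ^ n) : dyadic n i ≤ 1 :=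
  ((dyadic_strictMono n).monotone hi).trans_eq (dyadic_two_pow n)

lemma dyadic_succ_sub_dyadic (n i : ℕ) : dyadic n (i + 1) - dyadic n i = (2 ^ n)⁻¹ := by
  simp only [dyadic, Nat.cast_succ]
  ring

lemma dyadic_succ_two_mul (n i : ℕ) : dyadic (n + 1) (2 * i) = dyadic n i := by
  simp only [dyadic, Nat.cast_mul, Nat.cast_ofNat, pow_succ]
  field_simp

lemma dyadic_succ_two_mul_add_one (n i : ℕ) :
    dyadic (n + 1) (2 * i + 1) = (dyadic n i + dyadic n (i + 1)) / 2 := by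
  simp only [dyadic, Nat.cast_succ, Nat.cast_mul, pow_succ]
  field_simp
  ring

lemma dyadic_lt_dyadic_succ_odd (n i : ℕ) : dyadic n i < dyadic (n + 1) (2 * i + 1) := by
  rw [← dyadic_succ_two_mul]
  exact dyadic_strictMono _ (by omega)

lemma dyadic_succ_odd_lt_dyadic (n i : ℕ) : dyadic (n + 1) (2 * i + 1) < dyadic n (i + 1) := by
  rw [← dyadic_succ_two_mul n]
  exact dyadic_strictMono _ (by omega)

lemma exists_dyadic_le_lt (n : ℕ) {t : ℝ} (ht : t ∈ Set.Ico (0 : ℝ) 1) :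
    ∃ i < 2 ^ n, dyadic n i ≤ t ∧ t < dyadic n (i + 1) := by
  have hpow : (0 : ℝ) < 2 ^ n := by positivity
  have hfloor : dyadic n ⌊t * 2 ^ n⌋₊ ≤ t :=
    (div_le_iff₀ hpow).2 (Nat.floor_le (mul_nonneg ht.1 hpow.le))
  refine ⟨_, (dyadic_strictMono n).lt_iff_lt.1 (hfloor.trans_lt ?_), hfloor, ?_⟩
  · simpa using ht.2
  · rw [dyadic, lt_div_iff₀ hpow, Nat.cast_succ]
    exact Nat.lt_floor_add_one _

/-- The dyadic fractions with denominator `2 ^ n` in the open unit interval. -/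
def dyadicGrid (n : ℕ) : Finset ℝ := (Finset.Ioo 0 (2 ^ n)).image (dyadic n)

lemma mem_dyadicGrid {n : ℕ} {t : ℝ} :
    t ∈ dyadicGrid n ↔ ∃ i, (0 < i ∧ i < 2 ^ n) ∧ dyadic n i = t := by
  simp only [dyadicGrid, Finset.mem_image, Finset.mem_Ioo]

lemma dyadic_mem_dyadicGrid {n i : ℕ} : dyadic n i ∈ dyadicGrid n ↔ 0 < i ∧ i < 2 ^ n := by
  rw [dyadicGrid, (dyadic_strictMono n).injective.mem_finset_image, Finset.mem_Ioo]

lemma card_dyadicGrid (n : ℕ) : (dyadicGrid n).card = 2 ^ n - 1 := by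
  rw [dyadicGrid, Finset.card_image_of_injective _ (dyadic_strictMono n).injective, Nat.card_Ioo,
    Nat.sub_zero]

lemma dyadicGrid_mono : Monotone dyadicGrid := by
  refine monotone_nat_of_le_succ fun n t ht => ?_
  obtain ⟨i, hi, rfl⟩ := mem_dyadicGrid.1 ht
  rw [← dyadic_succ_two_mul, dyadic_mem_dyadicGrid, pow_succ]
  omega

lemma dyadicGrid_subset_Ioo (n : ℕ) : (dyadicGrid n : Set ℝ) ⊆ Set.Ioo 0 1 := by
  intro t ht
  obtain ⟨i, hi, rfl⟩ := mem_dyadicGrid.1 ht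
  rw [← dyadic_zero_right n, ← dyadic_two_pow n]
  exact ⟨dyadic_strictMono n hi.1, dyadic_strictMono n hi.2⟩

lemma mem_dyadicGrid_succ_sdiff {n : ℕ} {t : ℝ} :
    t ∈ dyadicGrid (n + 1) \ dyadicGrid n ↔ ∃ i < 2 ^ n, dyadic (n + 1) (2 * i + 1) = t := by
  rw [Finset.mem_sdiff]
  constructor
  · rintro ⟨ht, hnew⟩
    obtain ⟨j, hj, rfl⟩ := mem_dyadicGrid.1 ht
    rw [pow_succ] at hj
    rcases Nat.even_or_odd' j with ⟨i, rfl | rfl⟩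
    · rw [dyadic_succ_two_mul, dyadic_mem_dyadicGrid] at hnew
      omega
    · exact ⟨i, by omega, rfl⟩
  · rintro ⟨i, hi, rfl⟩
    refine ⟨dyadic_mem_dyadicGrid.2 ⟨by omega, by rw [pow_succ]; omega⟩, fun h => ?_⟩
    obtain ⟨j, -, hj⟩ := mem_dyadicGrid.1 h
    rw [← dyadic_succ_two_mul, (dyadic_strictMono _).injective.eq_iff] at hj
    omega

lemma eq_of_mem_dyadicGrid_succ_of_mem_Ioo {n i : ℕ} {t : ℝ} (ht : t ∈ dyadicGrid (n + 1))
    (hcell : t ∈ Set.Ioo (dyadic n i) (dyadic n (i + 1))) : t = dyadic (n + 1) (2 * i + 1) := by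
  obtain ⟨j, -, rfl⟩ := mem_dyadicGrid.1 ht
  simp only [← dyadic_succ_two_mul n, Set.mem_Ioo, (dyadic_strictMono _).lt_iff_lt] at hcell
  rw [show j = 2 * i + 1 by omega]

lemma exists_mem_dyadicGrid_mem_Ioo {a b : ℝ} (ha : 0 ≤ a) (hab : a < b) (hb : b ≤ 1) :
    ∃ n, ∃ t ∈ dyadicGrid n, t ∈ Set.Ioo a b := by
  obtain ⟨n, hn⟩ := exists_pow_lt_of_lt_one (sub_pos.2 hab) (show (2⁻¹ : ℝ) < 1 by norm_num)
  obtain ⟨i, -, hle, hlt⟩ := exists_dyadic_le_lt n ⟨ha, hab.trans_le hb⟩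
  have hltb : dyadic n (i + 1) < b := by
    rw [inv_pow] at hn
    linarith [dyadic_succ_sub_dyadic n i]
  have hi : i + 1 < 2 ^ n := by
    rw [← (dyadic_strictMono n).lt_iff_lt, dyadic_two_pow]
    exact hltb.trans_le hb
  exact ⟨n, _, dyadic_mem_dyadicGrid.2 ⟨i.succ_pos, hi⟩, hlt, hltb⟩

/-- `t` is a dyadic fraction that is not among `y 0, …, y (k - 1)` and has the least possible
denominator: the grid of level `Nat.log 2 (k + 1)` has at most `k` points and the next one has
more. -/
def IsFreshDyadic (y : ℕ → ℝ) (k : ℕ) (t : ℝ) : Prop :=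
  t ∈ dyadicGrid (Nat.log 2 (k + 1) + 1) ∧ ∀ j < k, y j ≠ t

/-- A sequence that exhausts each grid of dyadic fractions before it enters the next one. -/
def IsDyadicEnumeration (y : ℕ → ℝ) : Prop := ∀ k, IsFreshDyadic y k (y k)

lemma log_succ_lt_iff {k n : ℕ} : Nat.log 2 (k + 1) < n ↔ k < 2 ^ n - 1 := by
  rw [Nat.log_lt_iff_lt_pow one_lt_two k.succ_ne_zero]
  omega

lemma IsFreshDyadic.mem_dyadicGrid_of_lt {y : ℕ → ℝ} {k n : ℕ} {t : ℝ} (h : IsFreshDyadic y k t)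
    (hk : k < 2 ^ n - 1) : t ∈ dyadicGrid n :=
  dyadicGrid_mono (Nat.succ_le_of_lt (log_succ_lt_iff.2 hk)) h.1

lemma exists_isFreshDyadic (y : ℕ → ℝ) (k : ℕ) : ∃ t, IsFreshDyadic y k t := by
  classical
  obtain ⟨t, ht, hne⟩ : ∃ t ∈ dyadicGrid (Nat.log 2 (k + 1) + 1), t ∉ (Finset.range k).image y := by
    refine Finset.exists_mem_notMem_of_card_lt_card (Finset.card_image_le.trans_lt ?_)
    rw [card_dyadicGrid, Finset.card_range]
    exact log_succ_lt_iff.1 (Nat.lt_succ_self _)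
  exact ⟨t, ht, fun j hj he => hne (Finset.mem_image.2 ⟨j, Finset.mem_range.2 hj, he⟩)⟩

lemma injOn_of_isFreshDyadic {y : ℕ → ℝ} {s : Set ℕ} (hy : ∀ j ∈ s, IsFreshDyadic y j (y j)) :
    Set.InjOn y s := by
  intro i hi j hj hij
  rcases lt_trichotomy i j with h | h | h
  · exact absurd hij ((hy j hj).2 i h)
  · exact h
  · exact absurd hij.symm ((hy i hi).2 j h)

lemma dyadicGrid_subset_image {y : ℕ → ℝ} {n : ℕ}
    (hy : ∀ j < 2 ^ n - 1, IsFreshDyadic y j (y j)) :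
    (dyadicGrid n : Set ℝ) ⊆ y '' Set.Iio (2 ^ n - 1) := by
  classical
  have hsub : (Finset.range (2 ^ n - 1)).image y ⊆ dyadicGrid n := Finset.image_subset_iff.2
    fun j hj => (hy j (Finset.mem_range.1 hj)).mem_dyadicGrid_of_lt (Finset.mem_range.1 hj)
  have hinj : Set.InjOn y (Finset.range (2 ^ n - 1)) :=
    injOn_of_isFreshDyadic fun j hj => hy j (Finset.mem_range.1 hj)
  have heq := Finset.eq_of_subset_of_card_le hsub <| by
    rw [card_dyadicGrid, Finset.card_image_of_injOn hinj, Finset.card_range]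
  rw [← heq, Finset.coe_image, Finset.coe_range]

lemma exists_eq_of_mem_dyadicGrid_log {y : ℕ → ℝ} {k : ℕ}
    (hy : ∀ j < k, IsFreshDyadic y j (y j)) {s : ℝ} (hs : s ∈ dyadicGrid (Nat.log 2 (k + 1))) :
    ∃ j < k, y j = s := by
  have hk : 2 ^ Nat.log 2 (k + 1) - 1 ≤ k := by
    rw [tsub_le_iff_right]
    exact Nat.pow_log_le_self 2 k.succ_ne_zero
  obtain ⟨j, hj, he⟩ := dyadicGrid_subset_image (fun j hj => hy j (hj.trans_le hk)) hs
  exact ⟨j, lt_of_lt_of_le hj hk, he⟩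

lemma IsFreshDyadic.exists_eq_dyadic {y : ℕ → ℝ} {k : ℕ} {t : ℝ} (ht : IsFreshDyadic y k t)
    (hy : ∀ j < k, IsFreshDyadic y j (y j)) :
    ∃ i < 2 ^ Nat.log 2 (k + 1), dyadic (Nat.log 2 (k + 1) + 1) (2 * i + 1) = t := by
  refine mem_dyadicGrid_succ_sdiff.1 (Finset.mem_sdiff.2 ⟨ht.1, fun hold => ?_⟩)
  obtain ⟨j, hj, he⟩ := exists_eq_of_mem_dyadicGrid_log hy hold
  exact ht.2 j hj he

namespace IsDyadicEnumeration

variable {y : ℕ → ℝ} (hy : IsDyadicEnumeration y)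
include hy

lemma injective : Function.Injective y :=
  Set.injOn_univ.1 (injOn_of_isFreshDyadic fun j _ => hy j)

lemma range_eq_iUnion : Set.range y = ⋃ n, (dyadicGrid n : Set ℝ) := by
  refine Set.Subset.antisymm ?_ (Set.iUnion_subset fun n => ?_)
  · rintro _ ⟨k, rfl⟩
    exact Set.mem_iUnion.2 ⟨_, (hy k).1⟩
  · exact (dyadicGrid_subset_image fun j _ => hy j).trans (Set.image_subset_range _ _)

lemma exists_mem_Ioo {a b : ℝ} (ha : 0 ≤ a) (hab : a < b) (hb : b ≤ 1) :
    ∃ k, y k ∈ Set.Ioo a b := by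
  obtain ⟨n, t, ht, htab⟩ := exists_mem_dyadicGrid_mem_Ioo ha hab hb
  obtain ⟨k, -, rfl⟩ := dyadicGrid_subset_image (fun j _ => hy j) ht
  exact ⟨k, htab⟩

end IsDyadicEnumeration

lemma exists_dyadicThreshold_eq (k : ℕ) :
    ∃ i < 2 ^ Nat.log 2 (k + 1), i + (k + 2) = 2 ^ (Nat.log 2 (k + 1) + 1) ∧
      dyadicThreshold k = dyadic (Nat.log 2 (k + 1) + 1) (2 * i + 1) := by
  have hlow : 2 ^ Nat.log 2 (k + 1) ≤ k + 1 := Nat.pow_log_le_self 2 k.succ_ne_zero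
  have hhigh : k + 1 < 2 ^ (Nat.log 2 (k + 1) + 1) := Nat.lt_pow_succ_log_self one_lt_two _
  obtain ⟨i, hi⟩ := Nat.exists_eq_add_of_lt hhigh
  refine ⟨i, by rw [pow_succ] at hi; omega, by omega, ?_⟩
  have hcast : (2 : ℝ) ^ (Nat.log 2 (k + 1) + 1) = k + 1 + i + 1 := by exact_mod_cast hi
  rw [dyadicThreshold, dyadic, Nat.cast_succ, Nat.cast_mul, Nat.cast_ofNat]
  congr 1
  linarith

lemma isDyadicEnumeration_dyadicThreshold : IsDyadicEnumeration dyadicThreshold := by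
  have hnew (k : ℕ) : dyadicThreshold k ∈
      dyadicGrid (Nat.log 2 (k + 1) + 1) \ dyadicGrid (Nat.log 2 (k + 1)) := by
    obtain ⟨i, hi, -, he⟩ := exists_dyadicThreshold_eq k
    exact mem_dyadicGrid_succ_sdiff.2 ⟨i, hi, he.symm⟩
  intro k
  refine ⟨(Finset.mem_sdiff.1 (hnew k)).1, fun j hj he => ?_⟩
  have hlog : Nat.log 2 (j + 1) ≤ Nat.log 2 (k + 1) := Nat.log_mono_right (by omega)
  rcases hlog.lt_or_eq with hlt | heq
  · have hold := dyadicGrid_mono (Nat.succ_le_of_lt hlt) (Finset.mem_sdiff.1 (hnew j)).1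
    rw [he] at hold
    exact (Finset.mem_sdiff.1 (hnew k)).2 hold
  · obtain ⟨i, -, hik, hi⟩ := exists_dyadicThreshold_eq k
    obtain ⟨i', -, hij, hi'⟩ := exists_dyadicThreshold_eq j
    rw [hi, hi', heq, (dyadic_strictMono _).injective.eq_iff] at he
    rw [heq] at hij
    omega

/-! ### Feedback and delay -/

instance : Countable Feedback :=
  ⟨fun | .idle => 0 | .success => 1 | .collision => 2, by rintro ⟨⟩ ⟨⟩ <;> simp⟩

open Classical in
lemma feedback_eq (r : Range) (x : Fin 2 → ℝ) :
    feedback r x =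
      if x 0 ∈ Set.Ioc r.1 r.2 then
        if x 1 ∈ Set.Ioc r.1 r.2 then .collision else .success
      else if x 1 ∈ Set.Ioc r.1 r.2 then .success else .idle := by
  unfold feedback
  rw [Finset.card_filter, Fin.sum_univ_two]
  split_ifs <;> rfl

lemma feedback_eq_idle_iff {r : Range} {x : Fin 2 → ℝ} :
    feedback r x = .idle ↔ ∀ i, x i ∉ Set.Ioc r.1 r.2 := by
  rw [feedback_eq, Fin.forall_fin_two]
  split_ifs <;> simp_all

lemma feedback_eq_collision_iff {r : Range} {x : Fin 2 → ℝ} :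
    feedback r x = .collision ↔ ∀ i, x i ∈ Set.Ioc r.1 r.2 := by
  rw [feedback_eq, Fin.forall_fin_two]
  split_ifs <;> simp_all

lemma feedback_eq_success_iff {r : Range} {x : Fin 2 → ℝ} :
    feedback r x = .success ↔ (x 0 ∈ Set.Ioc r.1 r.2 ∧ x 1 ∉ Set.Ioc r.1 r.2) ∨
      (x 1 ∈ Set.Ioc r.1 r.2 ∧ x 0 ∉ Set.Ioc r.1 r.2) := by
  rw [feedback_eq]
  split_ifs <;> simp_all

lemma measurableSet_feedback_eq (r : Range) (f : Feedback) :
    MeasurableSet {x : Fin 2 → ℝ | feedback r x = f} := by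
  have h (i : Fin 2) : MeasurableSet {x : Fin 2 → ℝ | x i ∈ Set.Ioc r.1 r.2} :=
    measurable_pi_apply i measurableSet_Ioc
  cases f with
  | idle =>
    simp only [feedback_eq_idle_iff, Fin.forall_fin_two]
    exact (h 0).compl.inter (h 1).compl
  | success =>
    simp only [feedback_eq_success_iff]
    exact ((h 0).inter (h 1).compl).union ((h 1).inter (h 0).compl)
  | collision =>
    simp only [feedback_eq_collision_iff, Fin.forall_fin_two]
    exact (h 0).inter (h 1)

@[simp] lemma length_history (σ : Strategy) (x : Fin 2 → ℝ) (n : ℕ) :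
    (history σ x n).length = n := by
  induction n with
  | zero => rfl
  | succ n ih => rw [history, List.length_append, ih, List.length_singleton]

lemma history_succ_eq_append_iff {σ : Strategy} {x : Fin 2 → ℝ} {n : ℕ} {h : List Feedback}
    {f : Feedback} :
    history σ x (n + 1) = h ++ [f] ↔ history σ x n = h ∧ feedback (σ h) x = f := by
  rw [history, ← List.concat_eq_append, ← List.concat_eq_append, List.concat_inj]
  exact and_congr_right fun hh => by rw [hh]

lemma measurableSet_history_mem (σ : Strategy) (n : ℕ) (s : Set (List Feedback)) :
    MeasurableSet {x : Fin 2 → ℝ | history σ x n ∈ s} := by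
  have hsingleton (h : List Feedback) : MeasurableSet {x : Fin 2 → ℝ | history σ x n = h} := by
    induction n generalizing h with
    | zero => exact MeasurableSet.const ([] = h)
    | succ n ih =>
      rcases List.eq_nil_or_concat h with rfl | ⟨h, f, rfl⟩
      · simp [history]
      · simp only [List.concat_eq_append, history_succ_eq_append_iff]
        exact (ih h).inter (measurableSet_feedback_eq _ _)
  have hunion : {x : Fin 2 → ℝ | history σ x n ∈ s} = ⋃ h ∈ s, {x | history σ x n = h} := by
    ext x
    simp only [Set.mem_ofPred_eq, Set.mem_iUnion, exists_prop, exists_eq_right']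
  rw [hunion]
  exact MeasurableSet.biUnion s.to_countable fun h _ => hsingleton h

lemma success_notMem_history_iff {σ : Strategy} {x : Fin 2 → ℝ} {n : ℕ} :
    Feedback.success ∉ history σ x n ↔
      ∀ m < n, feedback (σ (history σ x m)) x ≠ .success := by
  induction n with
  | zero => simp [history]
  | succ n ih =>
    rw [history, List.mem_append, not_or, ih, List.mem_singleton, Nat.forall_lt_succ_right,
      eq_comm]

lemma FirstSuccess.success_notMem_history {σ : Strategy} {x : Fin 2 → ℝ} {n : ℕ}
    (h : FirstSuccess σ x n) : Feedback.success ∉ history σ x n :=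
  success_notMem_history_iff.2 h.2

lemma exists_firstSuccess {σ : Strategy} {x : Fin 2 → ℝ} {n : ℕ}
    (h : Feedback.success ∈ history σ x n) : ∃ m, FirstSuccess σ x m := by
  classical
  have hex : ∃ m, feedback (σ (history σ x m)) x = .success := by
    by_contra! hne
    exact success_notMem_history_iff.2 (fun m _ => hne m) h
  exact ⟨Nat.find hex, Nat.find_spec hex, fun m hm => Nat.find_min hex hm⟩

lemma FirstSuccess.delay_eq {σ : Strategy} {x : Fin 2 → ℝ} {n : ℕ} (h : FirstSuccess σ x n) :
    delay σ x = n + 1 := by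
  refine le_antisymm (iInf₂_le n h) (le_iInf₂ fun m hm => ?_)
  have hnm : n ≤ m := not_lt.1 fun hlt => h.2 m hlt hm.1
  gcongr

open Classical in
lemma delay_eq_tsum (σ : Strategy) (x : Fin 2 → ℝ) :
    delay σ x = ∑' n, if Feedback.success ∉ history σ x n then 1 else 0 := by
  by_cases hN : ∃ N, FirstSuccess σ x N
  · obtain ⟨N, hN⟩ := hN
    have hmem (n : ℕ) : Feedback.success ∉ history σ x n ↔ n ∈ Finset.range (N + 1) := by
      rw [success_notMem_history_iff, Finset.mem_range, Nat.lt_succ_iff]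
      exact ⟨fun h => not_lt.1 fun hlt => h N hlt hN.1, fun h m hm => hN.2 m (hm.trans_le h)⟩
    rw [hN.delay_eq, tsum_eq_sum fun n hn => if_neg ((hmem n).not.2 hn),
      Finset.sum_congr rfl fun n hn => if_pos ((hmem n).2 hn)]
    simp
  · have hno (n : ℕ) : Feedback.success ∉ history σ x n := fun h => hN (exists_firstSuccess h)
    have hdelay : delay σ x = ⊤ := by
      simp only [delay, iInf_eq_top]
      exact fun n hn => absurd ⟨n, hn⟩ hN
    rw [hdelay, tsum_congr fun n => if_pos (hno n)]
    exact (ENNReal.tsum_const_eq_top_of_ne_zero one_ne_zero).symm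

lemma expectedDelay_eq_tsum {Ω : Type*} [MeasurableSpace Ω] {P : Measure Ω} {X : Fin 2 → Ω → ℝ}
    (hX : ∀ i, Measurable (X i)) (σ : Strategy) :
    expectedDelay P X σ = ∑' n, P {ω | Feedback.success ∉ history σ (fun i => X i ω) n} := by
  classical
  have hmeas (n : ℕ) : MeasurableSet {ω | Feedback.success ∉ history σ (fun i => X i ω) n} :=
    measurable_pi_lambda (fun ω i => X i ω) hX
      (measurableSet_history_mem σ n {h | Feedback.success ∉ h})
  simp only [expectedDelay, delay_eq_tsum]
  rw [lintegral_tsum fun n =>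
    (Measurable.ite (hmeas n) measurable_const measurable_const).aemeasurable]
  refine tsum_congr fun n => ?_
  rw [← lintegral_indicator_one (hmeas n)]
  exact lintegral_congr fun ω => by simp only [Set.indicator, Set.mem_ofPred_eq, Pi.one_apply]

/-! ### The least expected delay -/

/-- The number with binary digits `collision ↦ 1`, `idle ↦ 0`, most significant digit first: it
numbers the words of each length without a `success`, and after such a word bisection has located
both gains in the dyadic cell with this number. -/
def cellIndex (h : List Feedback) : ℕ :=
  h.foldl (fun i f => match f with
    | .collision => 2 * i + 1
    | _ => 2 * i) 0

@[simp] lemma cellIndex_nil : cellIndex [] = 0 := rfl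

@[simp] lemma cellIndex_append_collision (h : List Feedback) :
    cellIndex (h ++ [.collision]) = 2 * cellIndex h + 1 := by
  simp [cellIndex]

@[simp] lemma cellIndex_append_idle (h : List Feedback) :
    cellIndex (h ++ [.idle]) = 2 * cellIndex h := by
  simp [cellIndex]

lemma cellIndex_lt (h : List Feedback) : cellIndex h < 2 ^ h.length := by
  induction h using List.reverseRecOn with
  | nil => simp
  | append_singleton h f ih =>
    rw [List.length_append, List.length_singleton, pow_succ]
    cases f <;> simp [cellIndex] at ih ⊢ <;> omega

lemma eq_of_cellIndex_eq {h h' : List Feedback} (hs : Feedback.success ∉ h)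
    (hs' : Feedback.success ∉ h') (hlen : h.length = h'.length)
    (hidx : cellIndex h = cellIndex h') : h = h' := by
  induction h using List.reverseRecOn generalizing h' with
  | nil => exact (List.length_eq_zero_iff.1 hlen.symm).symm
  | append_singleton h f ih =>
    rcases List.eq_nil_or_concat h' with rfl | ⟨h', f', rfl⟩
    · simp at hlen
    · simp only [List.concat_eq_append, List.mem_append, List.mem_singleton, not_or,
        List.length_append, List.length_singleton, add_left_inj] at hs hs' hlen hidx ⊢
      have hinit := ih hs.1 hs'.1 hlen
      cases f <;> cases f' <;> grind [cellIndex_append_collision, cellIndex_append_idle]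

lemma feedback_eq_of_const {r : Range} {x : Fin 2 → ℝ} {f : Feedback}
    (h : ∀ i, feedback r (fun _ => x i) = f) : feedback r x = f := by
  cases f with
  | idle =>
    simp only [feedback_eq_idle_iff] at h ⊢
    exact fun i => h i i
  | success =>
    have := feedback_eq_success_iff.1 (h 0)
    tauto
  | collision =>
    simp only [feedback_eq_collision_iff] at h ⊢
    exact fun i => h i i

lemma history_eq_of_const {σ : Strategy} {x : Fin 2 → ℝ} {n : ℕ} {h : List Feedback}
    (hx : ∀ i, history σ (fun _ => x i) n = h) : history σ x n = h := by
  induction n generalizing h with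
  | zero => exact hx 0
  | succ n ih =>
    rcases List.eq_nil_or_concat h with rfl | ⟨h, f, rfl⟩
    · exact absurd (hx 0) (by simp [history])
    · simp only [List.concat_eq_append, history_succ_eq_append_iff] at hx ⊢
      exact ⟨ih fun i => (hx i).1, feedback_eq_of_const fun i => (hx i).2⟩

lemma success_notMem_history_const (σ : Strategy) (t : ℝ) (n : ℕ) :
    Feedback.success ∉ history σ (fun _ => t) n := by
  rw [success_notMem_history_iff]
  intro m _
  rw [Ne, feedback_eq_success_iff]
  tauto

section LowerBound

variable {Ω : Type*} [MeasurableSpace Ω] {P : Measure Ω} [IsProbabilityMeasure P]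
  {X : Fin 2 → Ω → ℝ}

-- Two gains for which equal users would give the same history `h` give the history `h` together.
lemma inv_two_pow_le_prob_success_notMem_history (hX : ∀ i, Measurable (X i))
    (hindep : IndepFun (X 0) (X 1) P) (hident : IdentDistrib (X 0) (X 1) P P) (σ : Strategy)
    (n : ℕ) : 2⁻¹ ^ n ≤ P {ω | Feedback.success ∉ history σ (fun i => X i ω) n} := by
  set φ : ℝ → ℕ := fun t => cellIndex (history σ (fun _ => t) n)
  have hφ : Measurable φ := measurable_to_countable' fun c =>
    measurable_pi_lambda (fun (t : ℝ) (_ : Fin 2) => t) (fun _ => measurable_id)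
      (measurableSet_history_mem σ n {h | cellIndex h = c})
  have hrange (ω : Ω) : φ (X 0 ω) ∈ Finset.range (2 ^ n) := by
    simpa using cellIndex_lt (history σ (fun _ => X 0 ω) n)
  have hsub : {ω | φ (X 0 ω) = φ (X 1 ω)} ⊆
      {ω | Feedback.success ∉ history σ (fun i => X i ω) n} := by
    intro ω hω
    have heq : history σ (fun _ => X 1 ω) n = history σ (fun _ => X 0 ω) n :=
      eq_of_cellIndex_eq (success_notMem_history_const σ _ n) (success_notMem_history_const σ _ n)
        (by simp) hω.symm
    have hboth : history σ (fun i => X i ω) n = history σ (fun _ => X 0 ω) n :=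
      history_eq_of_const (Fin.forall_fin_two.2 ⟨rfl, heq⟩)
    simpa only [Set.mem_ofPred_eq, hboth] using success_notMem_history_const σ _ n
  have hreal := inv_card_le_prob_eq (hφ.comp (hX 0)) (hφ.comp (hX 1)) (hindep.comp hφ hφ)
    (hident.comp hφ) hrange
  calc (2⁻¹ : ℝ≥0∞) ^ n = ENNReal.ofReal ((Finset.range (2 ^ n)).card : ℝ)⁻¹ := by
        rw [Finset.card_range, ENNReal.ofReal_inv_of_pos (by positivity), ENNReal.ofReal_natCast,
          Nat.cast_pow, Nat.cast_ofNat, ENNReal.inv_pow]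
    _ ≤ P {ω | φ (X 0 ω) = φ (X 1 ω)} := ENNReal.ofReal_le_of_le_toReal hreal
    _ ≤ P {ω | Feedback.success ∉ history σ (fun i => X i ω) n} := measure_mono hsub

theorem two_le_expectedDelay (hX : ∀ i, Measurable (X i)) (hindep : IndepFun (X 0) (X 1) P)
    (hident : IdentDistrib (X 0) (X 1) P P) (σ : Strategy) : 2 ≤ expectedDelay P X σ := by
  rw [expectedDelay_eq_tsum hX, ← ENNReal.tsum_geometric_two]
  exact ENNReal.tsum_le_tsum (inv_two_pow_le_prob_success_notMem_history hX hindep hident σ)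

end LowerBound

/-! ### Two independent uniform gains -/

section Events

variable {Ω : Type*} {X : Fin 2 → Ω → ℝ} {l t u : ℝ}

/-- The event that both gains lie in `(l, u]`. -/
def box (X : Fin 2 → Ω → ℝ) (l u : ℝ) : Set Ω := {ω | ∀ i, X i ω ∈ Set.Ioc l u}

/-- The event that both gains lie in `(l, u]` and `t` separates them. -/
def split (X : Fin 2 → Ω → ℝ) (l t u : ℝ) : Set Ω :=
  box X l u ∩ {ω | Separates t (ordered fun i => X i ω)}

lemma box_eq_inter (X : Fin 2 → Ω → ℝ) (l u : ℝ) :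
    box X l u = X 0 ⁻¹' Set.Ioc l u ∩ X 1 ⁻¹' Set.Ioc l u := by
  ext ω
  simp [box, Fin.forall_fin_two]

lemma split_eq_union (X : Fin 2 → Ω → ℝ) (l t u : ℝ) :
    split X l t u = (X 0 ⁻¹' Set.Ioc l t ∩ X 1 ⁻¹' Set.Ioc t u) ∪
      (X 0 ⁻¹' Set.Ioc t u ∩ X 1 ⁻¹' Set.Ioc l t) := by
  ext ω
  simp only [split, box_eq_inter, Separates, ordered, Set.mem_inter_iff, Set.mem_union,
    Set.mem_preimage, Set.mem_ofPred_eq, Set.mem_Ioc, min_le_iff, lt_max_iff]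
  grind

lemma split_eq_empty (h : t ≤ l ∨ u ≤ t) : split X l t u = ∅ := by
  rw [Set.eq_empty_iff_forall_notMem]
  rintro ω ⟨hbox, hmin, hmax⟩
  rcases h with h | h
  · exact (h.trans_lt (lt_min (hbox 0).1 (hbox 1).1)).not_ge hmin
  · exact ((max_le (hbox 0).2 (hbox 1).2).trans h).not_gt hmax

lemma identifiesBest_iff {r : Range} {x : Fin 2 → ℝ} :
    IdentifiesBest r x ↔ (x 0 ∈ Set.Ioc r.1 r.2 ∧ x 1 ≤ r.1) ∨
      (x 1 ∈ Set.Ioc r.1 r.2 ∧ x 0 ≤ r.1) := by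
  have key {a b : ℝ} (ha : a ∈ Set.Ioc r.1 r.2) : (b ∉ Set.Ioc r.1 r.2 ∧ b < a) ↔ b ≤ r.1 :=
    ⟨fun ⟨hb, hba⟩ => not_lt.1 fun h => hb ⟨h, hba.le.trans ha.2⟩,
      fun hb => ⟨fun h => hb.not_gt h.1, hb.trans_lt ha.1⟩⟩
  simp only [IdentifiesBest, Fin.exists_fin_two, Fin.forall_fin_two, ne_eq, not_true_eq_false,
    IsEmpty.forall_iff, true_and, and_true, one_ne_zero, zero_ne_one, not_false_eq_true,
    forall_const]
  exact or_congr (and_congr_right key) (and_congr_right key)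

lemma box_inter_identifiesBest (l u : ℝ) (r : Range) :
    box X l u ∩ {ω | IdentifiesBest r fun i => X i ω} = split X l r.1 (min r.2 u) := by
  ext ω
  simp only [split, box_eq_inter, identifiesBest_iff, Separates, ordered, Set.mem_inter_iff,
    Set.mem_preimage, Set.mem_ofPred_eq, Set.mem_Ioc, le_min_iff, min_le_iff, lt_max_iff]
  grind

end Events

section Measurability

variable {Ω : Type*} [MeasurableSpace Ω] {X : Fin 2 → Ω → ℝ} (hX : ∀ i, Measurable (X i))
include hX

lemma measurable_ordered : Measurable fun ω => ordered fun i => X i ω :=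
  ((hX 0).min (hX 1)).prodMk ((hX 0).max (hX 1))

lemma measurableSet_separates (t : ℝ) :
    MeasurableSet {ω | Separates t (ordered fun i => X i ω)} :=
  (measurableSet_le ((hX 0).min (hX 1)) measurable_const).inter
    (measurableSet_lt measurable_const ((hX 0).max (hX 1)))

lemma measurableSet_identifiesBest (r : Range) :
    MeasurableSet {ω | IdentifiesBest r fun i => X i ω} := by
  simp only [identifiesBest_iff]
  exact ((hX 0 measurableSet_Ioc).inter (hX 1 measurableSet_Iic)).union
    ((hX 1 measurableSet_Ioc).inter (hX 0 measurableSet_Iic))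

end Measurability

section Law

variable {Ω : Type*} [MeasurableSpace Ω] {P : Measure Ω} {X : Fin 2 → Ω → ℝ}

lemma ae_ne_of_indepFun [IsFiniteMeasure P] {U V : Ω → ℝ} [NullSingletonClass (P.map V)]
    (hU : Measurable U) (hV : Measurable V) (hUV : IndepFun U V P) : ∀ᵐ ω ∂P, U ω ≠ V ω := by
  have hdiag : MeasurableSet {q : ℝ × ℝ | q.1 = q.2} :=
    measurableSet_eq_fun measurable_fst measurable_snd
  have hnull : P.map (fun ω => (U ω, V ω)) {q | q.1 = q.2} = 0 := by
    rw [(indepFun_iff_map_prod_eq_prod_map_map hU.aemeasurable hV.aemeasurable).1 hUV,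
      Measure.measure_prod_null hdiag]
    refine .of_forall fun x => measure_mono_null (t := {x}) ?_ (measure_singleton x)
    exact fun y hy => hy.symm
  rw [Measure.map_apply (hU.prodMk hV) hdiag] at hnull
  exact measure_eq_zero_iff_ae_notMem.1 hnull

/-- The two gains are independent, and each of them is uniform on `[0, 1]`. -/
structure IsUniformPair (P : Measure Ω) (X : Fin 2 → Ω → ℝ) : Prop where
  measurable : ∀ i, Measurable (X i)
  map_eq : ∀ i, P.map (X i) = volume.restrict (Set.Icc 0 1)
  indepFun : IndepFun (X 0) (X 1) P

lemma isUniformPair_of_iIndepFun (hmeas : ∀ i, Measurable (X i))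
    (hunif : ∀ i, pdf.IsUniform (X i) (Set.Icc (0 : ℝ) 1) P volume) (hindep : iIndepFun X P) :
    IsUniformPair P X where
  measurable := hmeas
  map_eq i := by
    have h : P.map (X i) = ProbabilityTheory.cond volume (Set.Icc 0 1) := hunif i
    simpa [ProbabilityTheory.cond] using h
  indepFun := hindep.indepFun (by decide)

namespace IsUniformPair

variable (hX : IsUniformPair P X)
include hX

lemma identDistrib : IdentDistrib (X 0) (X 1) P P :=
  ⟨(hX.measurable 0).aemeasurable, (hX.measurable 1).aemeasurable,
    (hX.map_eq 0).trans (hX.map_eq 1).symm⟩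

lemma ae_mem_Ioc : ∀ᵐ ω ∂P, ∀ i, X i ω ∈ Set.Ioc (0 : ℝ) 1 := by
  refine ae_all_iff.2 fun i => ae_of_ae_map (hX.measurable i).aemeasurable ?_
  rw [hX.map_eq, ← Measure.restrict_congr_set Ioc_ae_eq_Icc]
  exact ae_restrict_mem measurableSet_Ioc

lemma ae_ne [IsFiniteMeasure P] : ∀ᵐ ω ∂P, X 0 ω ≠ X 1 ω := by
  have : NullSingletonClass (P.map (X 1)) := by rw [hX.map_eq]; infer_instance
  exact ae_ne_of_indepFun (hX.measurable 0) (hX.measurable 1) hX.indepFun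

lemma prob_preimage_Ioc (i : Fin 2) {a b : ℝ} (ha : 0 ≤ a) (hb : b ≤ 1) :
    P (X i ⁻¹' Set.Ioc a b) = ENNReal.ofReal (b - a) := by
  rw [← Measure.map_apply (hX.measurable i) measurableSet_Ioc, hX.map_eq,
    Measure.restrict_apply measurableSet_Ioc, Set.inter_eq_left.2, Real.volume_Ioc]
  exact fun x hx => ⟨ha.trans hx.1.le, hx.2.trans hb⟩

lemma real_Ioc_inter_Ioc {a b c d : ℝ} (ha : 0 ≤ a) (hab : a ≤ b) (hb : b ≤ 1) (hc : 0 ≤ c)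
    (hcd : c ≤ d) (hd : d ≤ 1) :
    P.real (X 0 ⁻¹' Set.Ioc a b ∩ X 1 ⁻¹' Set.Ioc c d) = (b - a) * (d - c) := by
  rw [Measure.real, hX.indepFun.measure_inter_preimage_eq_mul _ _ measurableSet_Ioc
    measurableSet_Ioc, hX.prob_preimage_Ioc 0 ha hb, hX.prob_preimage_Ioc 1 hc hd,
    ENNReal.toReal_mul, ENNReal.toReal_ofReal (sub_nonneg.2 hab),
    ENNReal.toReal_ofReal (sub_nonneg.2 hcd)]

lemma real_box {l u : ℝ} (hl : 0 ≤ l) (hlu : l ≤ u) (hu : u ≤ 1) :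
    P.real (box X l u) = (u - l) ^ 2 := by
  rw [box_eq_inter, hX.real_Ioc_inter_Ioc hl hlu hu hl hlu hu, sq]

variable [IsProbabilityMeasure P] {l t u v : ℝ}

lemma real_split (hl : 0 ≤ l) (hlt : l ≤ t) (htu : t ≤ u) (hu : u ≤ 1) :
    P.real (split X l t u) = 2 * ((t - l) * (u - t)) := by
  have hdisj : Disjoint (X 0 ⁻¹' Set.Ioc l t ∩ X 1 ⁻¹' Set.Ioc t u)
      (X 0 ⁻¹' Set.Ioc t u ∩ X 1 ⁻¹' Set.Ioc l t) :=
    Set.disjoint_left.2 fun ω h h' => h.1.2.not_gt h'.1.1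
  have ht0 := hl.trans hlt
  have ht1 := htu.trans hu
  rw [split_eq_union, measureReal_union hdisj
    ((hX.measurable 0 measurableSet_Ioc).inter (hX.measurable 1 measurableSet_Ioc)),
    hX.real_Ioc_inter_Ioc hl hlt ht1 ht0 htu hu, hX.real_Ioc_inter_Ioc ht0 htu hu hl hlt ht1]
  ring

lemma real_split_midpoint (hl : 0 ≤ l) (hlu : l ≤ u) (hu : u ≤ 1) :
    P.real (split X l ((l + u) / 2) u) = (u - l) ^ 2 / 2 := by
  rw [hX.real_split hl (by linarith) (by linarith) hu]
  ring

lemma real_split_le (hl : 0 ≤ l) (hu : u ≤ 1) (hv : v ≤ u) :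
    P.real (split X l t v) ≤ (u - l) ^ 2 / 2 := by
  by_cases h : t ≤ l ∨ v ≤ t
  · simp only [split_eq_empty h, measureReal_empty]
    positivity
  push Not at h
  rw [hX.real_split hl h.1.le h.2.le (hv.trans hu)]
  linarith [sq_nonneg (t - l - (u - t)),
    mul_nonneg (sub_nonneg.2 h.1.le) (sub_nonneg.2 hv)]

lemma eq_midpoint_of_le_real_split (hl : 0 ≤ l) (hlu : l < u) (hu : u ≤ 1) (hv : v ≤ u)
    (hle : (u - l) ^ 2 / 2 ≤ P.real (split X l t v)) : t = (l + u) / 2 ∧ v = u := by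
  by_cases h : t ≤ l ∨ v ≤ t
  · rw [split_eq_empty h, measureReal_empty] at hle
    linarith [pow_pos (sub_pos.2 hlu) 2]
  push Not at h
  rw [hX.real_split hl h.1.le h.2.le (hv.trans hu)] at hle
  have hsum : (t - (l + u) / 2) ^ 2 + (t - l) * (u - v) ≤ 0 := by linarith
  have hprod : 0 ≤ (t - l) * (u - v) :=
    mul_nonneg (sub_nonneg.2 h.1.le) (sub_nonneg.2 hv)
  obtain ⟨hsq, hend⟩ := (add_eq_zero_iff_of_nonneg (sq_nonneg _) hprod).1
    (hsum.antisymm (add_nonneg (sq_nonneg _) hprod))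
  have hmid : t - (l + u) / 2 = 0 := pow_eq_zero_iff two_ne_zero |>.1 hsq
  refine ⟨by linarith, ?_⟩
  rcases mul_eq_zero.1 hend with h' | h' <;> linarith

end IsUniformPair

end Law

/-! ### Bisection -/

/-- After the history `h`, the strategy probes at least the upper half of the dyadic cell with index
`cellIndex h`. The top of the range is free above that cell, where no gain is left. -/
def Bisects (σ : Strategy) (h : List Feedback) : Prop :=
  (σ h).1 = dyadic (h.length + 1) (2 * cellIndex h + 1) ∧
    dyadic h.length (cellIndex h + 1) ≤ (σ h).2

/-- A strategy that bisects the current dyadic cell as long as contention is unresolved. -/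
def IsBisecting (σ : Strategy) : Prop := ∀ h, Feedback.success ∉ h → Bisects σ h

lemma foldl_osaStep_two {h : List Feedback} (hs : Feedback.success ∉ h) :
    h.foldl (osaStep 2) ⟨0, 1 - 1 / (2 : ℕ), 1⟩ =
      ⟨dyadic h.length (cellIndex h), dyadic (h.length + 1) (2 * cellIndex h + 1),
        dyadic h.length (cellIndex h + 1)⟩ := by
  induction h using List.reverseRecOn with
  | nil => norm_num [dyadic]
  | append_singleton h f ih =>
    rw [List.mem_append, not_or] at hs
    rw [List.foldl_append, ih hs.1, List.length_append, List.length_singleton]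
    cases f with
    | idle =>
      rw [cellIndex_append_idle, dyadic_succ_two_mul_add_one (h.length + 1), dyadic_succ_two_mul]
      simp only [List.foldl_cons, List.foldl_nil, osaStep]
      split_ifs with hlow
      · rfl
      · rw [not_not.1 hlow, OSAState.mk.injEq]
        exact ⟨rfl, by push_cast; ring, rfl⟩
    | success => exact absurd (List.mem_singleton_self _) hs.2
    | collision =>
      rw [cellIndex_append_collision, dyadic_succ_two_mul_add_one (h.length + 1),
        show 2 * cellIndex h + 1 + 1 = 2 * (cellIndex h + 1) by ring, dyadic_succ_two_mul]
      rfl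

lemma isBisecting_osa_two : IsBisecting (osa 2) := fun h hs => by
  simp only [Bisects, osa, foldl_osaStep_two hs, le_refl, and_self]

section Pointwise

variable {σ : Strategy} {x : Fin 2 → ℝ} (hx : ∀ i, x i ∈ Set.Ioc (0 : ℝ) 1)
include hx

lemma history_eq_iff {h : List Feedback} (hs : Feedback.success ∉ h)
    (hσ : ∀ h', Feedback.success ∉ h' → h'.length < h.length → Bisects σ h') :
    history σ x h.length = h ↔
      ∀ i, x i ∈ Set.Ioc (dyadic h.length (cellIndex h)) (dyadic h.length (cellIndex h + 1)) := by
  induction h using List.reverseRecOn with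
  | nil => simpa [history, dyadic] using hx
  | append_singleton h f ih =>
    rw [List.mem_append, not_or] at hs
    simp only [List.length_append, List.length_singleton] at hσ ⊢
    obtain ⟨hmid, htop⟩ := hσ h hs.1 (Nat.lt_succ_self _)
    rw [history_succ_eq_append_iff,
      ih hs.1 fun h' hs' hlt => hσ h' hs' (hlt.trans (Nat.lt_succ_self _))]
    have hlow := dyadic_lt_dyadic_succ_odd h.length (cellIndex h)
    have hhigh := dyadic_succ_odd_lt_dyadic h.length (cellIndex h)
    cases f with
    | idle =>
      rw [feedback_eq_idle_iff, cellIndex_append_idle, dyadic_succ_two_mul, hmid, ← forall_and]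
      refine forall_congr' fun i => ⟨fun ⟨h1, h2⟩ => ⟨h1.1, ?_⟩, fun h1 => ⟨⟨h1.1, ?_⟩, ?_⟩⟩
      · exact not_lt.1 fun h3 => h2 ⟨h3, h1.2.trans htop⟩
      · exact h1.2.trans hhigh.le
      · exact fun h2 => h1.2.not_gt h2.1
    | success => exact absurd (List.mem_singleton_self _) hs.2
    | collision =>
      rw [feedback_eq_collision_iff, cellIndex_append_collision, hmid, ← forall_and,
        show 2 * cellIndex h + 1 + 1 = 2 * (cellIndex h + 1) by ring, dyadic_succ_two_mul]
      exact forall_congr' fun i => ⟨fun ⟨h1, h2⟩ => ⟨h2.1, h1.2⟩,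
        fun h1 => ⟨⟨hlow.trans h1.1, h1.2⟩, h1.1, h1.2.trans htop⟩⟩

namespace IsBisecting

variable (hσ : IsBisecting σ) {n : ℕ}
include hσ

lemma mem_Ioc_dyadic (hs : Feedback.success ∉ history σ x n) (i : Fin 2) :
    x i ∈ Set.Ioc (dyadic n (cellIndex (history σ x n)))
      (dyadic n (cellIndex (history σ x n) + 1)) := by
  simpa using (history_eq_iff hx hs fun h' hs' _ => hσ h' hs').1 (by simp) i

lemma exists_firstSuccess (hne : x 0 ≠ x 1) : ∃ n, FirstSuccess σ x n := by
  by_contra! hno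
  have hs (n : ℕ) : Feedback.success ∉ history σ x n := fun h =>
    (Contention.exists_firstSuccess h).elim hno
  obtain ⟨n, hn⟩ := exists_pow_lt_of_lt_one (abs_pos.2 (sub_ne_zero.2 hne))
    (show (2⁻¹ : ℝ) < 1 by norm_num)
  have h0 := hσ.mem_Ioc_dyadic hx (hs n) 0
  have h1 := hσ.mem_Ioc_dyadic hx (hs n) 1
  have hlen := dyadic_succ_sub_dyadic n (cellIndex (history σ x n))
  refine hn.not_ge ?_
  rw [inv_pow, ← hlen, abs_le]
  constructor <;> linarith [h0.1, h0.2, h1.1, h1.2]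

lemma identifiesBest (hn : FirstSuccess σ x n) : IdentifiesBest (σ (history σ x n)) x := by
  have hs := hn.success_notMem_history
  have htop := (hσ _ hs).2
  rw [length_history] at htop
  have hle {i : Fin 2} (hi : x i ∉ Set.Ioc (σ (history σ x n)).1 (σ (history σ x n)).2) :
      x i ≤ (σ (history σ x n)).1 :=
    not_lt.1 fun h => hi ⟨h, (hσ.mem_Ioc_dyadic hx hs i).2.trans htop⟩
  exact identifiesBest_iff.2
    ((feedback_eq_success_iff.1 hn.1).imp (And.imp_right hle) (And.imp_right hle))

lemma separates (hn : FirstSuccess σ x n) : Separates (σ (history σ x n)).1 (ordered x) := by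
  rcases identifiesBest_iff.1 (hσ.identifiesBest hx hn) with ⟨hmax, hmin⟩ | ⟨hmax, hmin⟩
  · exact ⟨(min_le_right _ _).trans hmin, hmax.1.trans_le (le_max_left _ _)⟩
  · exact ⟨(min_le_left _ _).trans hmin, hmax.1.trans_le (le_max_right _ _)⟩

end IsBisecting

end Pointwise

namespace IsUniformPair

variable {Ω : Type*} [MeasurableSpace Ω] {P : Measure Ω} {X : Fin 2 → Ω → ℝ}
  (hX : IsUniformPair P X) {σ : Strategy}
include hX

lemma history_eq_ae {h : List Feedback} (hs : Feedback.success ∉ h)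
    (hσ : ∀ h', Feedback.success ∉ h' → h'.length < h.length → Bisects σ h') :
    {ω | history σ (fun i => X i ω) h.length = h} =ᵐ[P]
      box X (dyadic h.length (cellIndex h)) (dyadic h.length (cellIndex h + 1)) := by
  filter_upwards [hX.ae_mem_Ioc] with ω hω
  exact propext (history_eq_iff hω hs hσ)

variable [IsProbabilityMeasure P]

lemma forall_cond_box_le_iff {l u : ℝ} (hl : 0 ≤ l) (hlu : l < u) (hu : u ≤ 1) (s : Range) :
    (∀ r : Range, P[|box X l u] {ω | IdentifiesBest r fun i => X i ω} ≤
      P[|box X l u] {ω | IdentifiesBest s fun i => X i ω}) ↔ s.1 = (l + u) / 2 ∧ u ≤ s.2 := by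
  have hbox : P (box X l u) ≠ 0 := (measureReal_ne_zero_iff).1 <| by
    rw [hX.real_box hl hlu.le hu]
    exact (pow_pos (sub_pos.2 hlu) 2).ne'
  have hmeas := measurableSet_identifiesBest hX.measurable
  simp only [fun r => cond_le_cond_iff hbox (hmeas r) (hmeas s), box_inter_identifiesBest]
  constructor
  · intro h
    have hle := h ((l + u) / 2, u)
    rw [min_self, hX.real_split_midpoint hl hlu.le hu] at hle
    exact (hX.eq_midpoint_of_le_real_split hl hlu hu (min_le_right _ _) hle).imp_right
      min_eq_right_iff.1
  · rintro ⟨hmid, htop⟩ r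
    rw [hmid, min_eq_right htop, hX.real_split_midpoint hl hlu.le hu]
    exact hX.real_split_le hl hu (min_le_right _ _)

lemma forall_cond_history_le_iff {h : List Feedback} (hs : Feedback.success ∉ h)
    (hσ : ∀ h', Feedback.success ∉ h' → h'.length < h.length → Bisects σ h') :
    (∀ r : Range, P[|{ω | history σ (fun i => X i ω) h.length = h}]
        {ω | IdentifiesBest r fun i => X i ω} ≤
      P[|{ω | history σ (fun i => X i ω) h.length = h}]
        {ω | IdentifiesBest (σ h) fun i => X i ω}) ↔ Bisects σ h := by
  rw [cond_congr_ae (hX.history_eq_ae hs hσ), Bisects, dyadic_succ_two_mul_add_one]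
  exact hX.forall_cond_box_le_iff (dyadic_nonneg _ _) (dyadic_strictMono _ (Nat.lt_succ_self _))
    (dyadic_le_one (cellIndex_lt h)) (σ h)

theorem isMPAStrategy_iff : IsMPAStrategy P X σ ↔ IsBisecting σ := by
  refine ⟨fun hM => ?_, fun hB h hs =>
    (hX.forall_cond_history_le_iff hs fun h' hs' _ => hB h' hs').2 (hB h hs)⟩
  suffices ∀ n, ∀ h : List Feedback, h.length = n → Feedback.success ∉ h → Bisects σ h from
    fun h hs => this _ h rfl hs
  intro n
  induction n using Nat.strong_induction_on with
  | _ n ih =>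
    rintro h rfl hs
    exact (hX.forall_cond_history_le_iff hs fun h' hs' hlt => ih _ hlt h' rfl hs').1 (hM h hs)

lemma prob_success_notMem_history_le (hσ : IsBisecting σ) (n : ℕ) :
    P {ω | Feedback.success ∉ history σ (fun i => X i ω) n} ≤ 2⁻¹ ^ n := by
  have hsub : {ω | Feedback.success ∉ history σ (fun i => X i ω) n} ≤ᵐ[P]
      ⋃ i ∈ Finset.range (2 ^ n), box X (dyadic n i) (dyadic n (i + 1)) := by
    filter_upwards [hX.ae_mem_Ioc] with ω hω hs
    have hlt := cellIndex_lt (history σ (fun i => X i ω) n)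
    rw [length_history] at hlt
    exact Set.mem_iUnion₂.2 ⟨_, Finset.mem_range.2 hlt, hσ.mem_Ioc_dyadic hω hs⟩
  have hbox (i : ℕ) (hi : i ∈ Finset.range (2 ^ n)) :
      P (box X (dyadic n i) (dyadic n (i + 1))) = 2⁻¹ ^ n * 2⁻¹ ^ n := by
    have hreal := hX.real_box (dyadic_nonneg n i) (dyadic_strictMono n (Nat.lt_succ_self i)).le
      (dyadic_le_one (Finset.mem_range.1 hi))
    rw [dyadic_succ_sub_dyadic] at hreal
    rw [← ofReal_measureReal, hreal, sq, ENNReal.ofReal_mul (by positivity), ← inv_pow,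
      ENNReal.ofReal_pow (by norm_num), ENNReal.ofReal_inv_of_pos two_pos, ENNReal.ofReal_ofNat]
  calc P {ω | Feedback.success ∉ history σ (fun i => X i ω) n}
      ≤ ∑ i ∈ Finset.range (2 ^ n), P (box X (dyadic n i) (dyadic n (i + 1))) :=
        (measure_mono_ae hsub).trans (measure_biUnion_finset_le _ _)
    _ = 2 ^ n * (2⁻¹ ^ n * 2⁻¹ ^ n) := by
        rw [Finset.sum_congr rfl hbox, Finset.sum_const, Finset.card_range, nsmul_eq_mul]
        norm_num
    _ = 2⁻¹ ^ n := by
        rw [← mul_assoc, ← mul_pow, ENNReal.mul_inv_cancel two_ne_zero ENNReal.ofNat_ne_top,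
          one_pow, one_mul]

theorem expectedDelay_eq_two (hσ : IsBisecting σ) : expectedDelay P X σ = 2 := by
  refine le_antisymm ?_ (two_le_expectedDelay hX.measurable hX.indepFun hX.identDistrib σ)
  rw [expectedDelay_eq_tsum hX.measurable, ← ENNReal.tsum_geometric_two]
  exact ENNReal.tsum_le_tsum (hX.prob_success_notMem_history_le hσ)

end IsUniformPair

/-! ### Maximal probability thresholds -/

section Thresholds

variable {Ω : Type*} {X : Fin 2 → Ω → ℝ} {y : ℕ → ℝ} {t : ℝ}

lemma mem_split_of_forall_not_separates {n i : ℕ} (hi : i < 2 ^ n) (hl : dyadic n i ≤ t)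
    (hu : t < dyadic n (i + 1)) {ω : Ω} (hω : ∀ i, X i ω ∈ Set.Ioc (0 : ℝ) 1)
    (hgrid : ∀ s ∈ dyadicGrid n, ¬ Separates s (ordered fun i => X i ω))
    (hsep : Separates t (ordered fun i => X i ω)) :
    ω ∈ split X (dyadic n i) t (dyadic n (i + 1)) := by
  have hmin : dyadic n i < min (X 0 ω) (X 1 ω) := by
    rcases Nat.eq_zero_or_pos i with rfl | hpos
    · simpa using ⟨(hω 0).1, (hω 1).1⟩
    · by_contra! hle
      exact hgrid _ (dyadic_mem_dyadicGrid.2 ⟨hpos, hi⟩) ⟨hle, hl.trans_lt hsep.2⟩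
  have hmax : max (X 0 ω) (X 1 ω) ≤ dyadic n (i + 1) := by
    rcases (Nat.succ_le_of_lt hi).eq_or_lt with hlast | hlt
    · rw [← Nat.succ_eq_add_one, hlast, dyadic_two_pow]
      exact max_le (hω 0).2 (hω 1).2
    · by_contra! hlt'
      exact hgrid _ (dyadic_mem_dyadicGrid.2 ⟨i.succ_pos, hlt⟩) ⟨hsep.1.trans hu.le, hlt'⟩
  rw [lt_min_iff] at hmin
  rw [max_le_iff] at hmax
  exact ⟨Fin.forall_fin_two.2 ⟨⟨hmin.1, hmax.1⟩, hmin.2, hmax.2⟩, hsep⟩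

lemma not_separates_of_mem_unresolved {k : ℕ} (hy : ∀ j < k, IsFreshDyadic y j (y j)) {ω : Ω}
    (hω : ω ∈ unresolved X y k) {s : ℝ} (hs : s ∈ dyadicGrid (Nat.log 2 (k + 1))) :
    ¬ Separates s (ordered fun i => X i ω) := by
  obtain ⟨j, hj, rfl⟩ := exists_eq_of_mem_dyadicGrid_log hy hs
  exact hω j hj

lemma eq_of_mem_dyadicGrid_succ_of_separates {n i : ℕ} {x : Fin 2 → ℝ}
    (hx : ∀ j, x j ∈ Set.Ioc (dyadic n i) (dyadic n (i + 1))) (ht : t ∈ dyadicGrid (n + 1))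
    (hsep : Separates t (ordered x)) : t = dyadic (n + 1) (2 * i + 1) :=
  eq_of_mem_dyadicGrid_succ_of_mem_Ioo ht ⟨(lt_min (hx 0).1 (hx 1).1).trans_le hsep.1,
    hsep.2.trans_le (max_le (hx 0).2 (hx 1).2)⟩

lemma half_sq_dyadic_succ_sub_dyadic (n i : ℕ) :
    (dyadic n (i + 1) - dyadic n i) ^ 2 / 2 = ((2 : ℝ) ^ (2 * n + 1))⁻¹ := by
  rw [dyadic_succ_sub_dyadic]
  ring

variable [MeasurableSpace Ω] {P : Measure Ω} [IsProbabilityMeasure P]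

namespace IsUniformPair

variable (hX : IsUniformPair P X) {k : ℕ} (hy : ∀ j < k, IsFreshDyadic y j (y j))
include hX hy

lemma real_unresolved_inter_separates (ht : IsFreshDyadic y k t) :
    P.real (unresolved X y k ∩ {ω | Separates t (ordered fun i => X i ω)}) =
      (2 ^ (2 * Nat.log 2 (k + 1) + 1))⁻¹ := by
  obtain ⟨i, hi, rfl⟩ := ht.exists_eq_dyadic hy
  set n := Nat.log 2 (k + 1)
  rw [← half_sq_dyadic_succ_sub_dyadic n i, ← hX.real_split_midpoint (dyadic_nonneg n i)
    (dyadic_strictMono n (Nat.lt_succ_self i)).le (dyadic_le_one hi),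
    ← dyadic_succ_two_mul_add_one]
  refine measureReal_congr ?_
  filter_upwards [hX.ae_mem_Ioc] with ω hω
  refine propext ⟨fun h => ?_, fun h => ⟨fun j hj hsep => ht.2 j hj ?_, h.2⟩⟩
  · exact mem_split_of_forall_not_separates hi (dyadic_lt_dyadic_succ_odd n i).le
      (dyadic_succ_odd_lt_dyadic n i) hω (fun s => not_separates_of_mem_unresolved hy h.1) h.2
  · have hlog : Nat.log 2 (j + 1) ≤ n := Nat.log_mono_right (Nat.succ_le_succ hj.le)
    exact eq_of_mem_dyadicGrid_succ_of_separates h.1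
      (dyadicGrid_mono (Nat.succ_le_succ hlog) (hy j hj).1) hsep

lemma exists_real_unresolved_inter_separates_le (ht : t ∈ Set.Icc (0 : ℝ) 1) :
    ∃ i < 2 ^ Nat.log 2 (k + 1),
      P.real (unresolved X y k ∩ {ω | Separates t (ordered fun i => X i ω)}) ≤
        P.real (split X (dyadic (Nat.log 2 (k + 1)) i) t
          (dyadic (Nat.log 2 (k + 1)) (i + 1))) := by
  rcases ht.2.eq_or_lt with rfl | ht1
  · have hnull : P {ω | Separates 1 (ordered fun i => X i ω)} = 0 := by
      rw [measure_eq_zero_iff_ae_notMem]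
      filter_upwards [hX.ae_mem_Ioc] with ω hω hsep
      exact (max_le (hω 0).2 (hω 1).2).not_gt hsep.2
    refine ⟨0, by positivity, ?_⟩
    rw [Measure.real, measure_mono_null Set.inter_subset_right hnull, ENNReal.toReal_zero]
    exact measureReal_nonneg
  · obtain ⟨i, hi, hl, hu⟩ := exists_dyadic_le_lt (Nat.log 2 (k + 1)) ⟨ht.1, ht1⟩
    refine ⟨i, hi, ENNReal.toReal_mono (measure_ne_top _ _) (measure_mono_ae ?_)⟩
    filter_upwards [hX.ae_mem_Ioc] with ω hω h
    exact mem_split_of_forall_not_separates hi hl hu hω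
      (fun s => not_separates_of_mem_unresolved hy h.1) h.2

lemma real_unresolved_inter_separates_le (ht : t ∈ Set.Icc (0 : ℝ) 1) :
    P.real (unresolved X y k ∩ {ω | Separates t (ordered fun i => X i ω)}) ≤
      (2 ^ (2 * Nat.log 2 (k + 1) + 1))⁻¹ := by
  obtain ⟨i, hi, hle⟩ := hX.exists_real_unresolved_inter_separates_le hy ht
  rw [← half_sq_dyadic_succ_sub_dyadic _ i]
  exact hle.trans (hX.real_split_le (dyadic_nonneg _ i) (dyadic_le_one hi) le_rfl)

lemma isFreshDyadic_of_le_real (ht : t ∈ Set.Icc (0 : ℝ) 1)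
    (hle : (2 ^ (2 * Nat.log 2 (k + 1) + 1))⁻¹ ≤
      P.real (unresolved X y k ∩ {ω | Separates t (ordered fun i => X i ω)})) :
    IsFreshDyadic y k t := by
  constructor
  · obtain ⟨i, hi, hsplit⟩ := hX.exists_real_unresolved_inter_separates_le hy ht
    rw [← half_sq_dyadic_succ_sub_dyadic _ i] at hle
    obtain ⟨hmid, -⟩ := hX.eq_midpoint_of_le_real_split (dyadic_nonneg _ i)
      (dyadic_strictMono _ (Nat.lt_succ_self i)) (dyadic_le_one hi) le_rfl (hle.trans hsplit)
    rw [hmid, ← dyadic_succ_two_mul_add_one]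
    exact (Finset.mem_sdiff.1 (mem_dyadicGrid_succ_sdiff.2 ⟨i, hi, rfl⟩)).1
  · rintro j hj rfl
    have hempty : unresolved X y k ∩ {ω | Separates (y j) (ordered fun i => X i ω)} = ∅ :=
      Set.eq_empty_iff_forall_notMem.2 fun ω hω => hω.1 j hj hω.2
    rw [hempty, measureReal_empty] at hle
    exact hle.not_gt (by positivity)

lemma forall_cond_unresolved_le_iff :
    (y k ∈ Set.Icc (0 : ℝ) 1 ∧ ∀ t ∈ Set.Icc (0 : ℝ) 1,
      P[|unresolved X y k] {ω | Separates t (ordered fun i => X i ω)} ≤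
      P[|unresolved X y k] {ω | Separates (y k) (ordered fun i => X i ω)}) ↔
    IsFreshDyadic y k (y k) := by
  have hmem {t : ℝ} (ht : IsFreshDyadic y k t) : t ∈ Set.Icc (0 : ℝ) 1 :=
    Set.Ioo_subset_Icc_self (dyadicGrid_subset_Ioo _ ht.1)
  obtain ⟨t₀, ht₀⟩ := exists_isFreshDyadic y k
  have hmass := hX.real_unresolved_inter_separates hy ht₀
  have hun : P (unresolved X y k) ≠ 0 := fun h => by
    rw [Measure.real, measure_mono_null Set.inter_subset_left h, ENNReal.toReal_zero] at hmass
    exact (inv_pos.2 (pow_pos two_pos _)).ne hmass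
  have hmeas := measurableSet_separates hX.measurable
  simp only [fun t => cond_le_cond_iff hun (hmeas t) (hmeas (y k))]
  constructor
  · rintro ⟨hyk, hmax⟩
    exact hX.isFreshDyadic_of_le_real hy hyk (hmass.symm.trans_le (hmax t₀ (hmem ht₀)))
  · intro hfresh
    refine ⟨hmem hfresh, fun t ht => ?_⟩
    rw [hX.real_unresolved_inter_separates hy hfresh]
    exact hX.real_unresolved_inter_separates_le hy ht

omit hy in
theorem isMPAThresholds_iff : IsMPAThresholds P X y ↔ IsDyadicEnumeration y := by
  refine ⟨fun hM k => ?_, fun hy k => (hX.forall_cond_unresolved_le_iff fun j _ => hy j).2 (hy k)⟩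
  induction k using Nat.strong_induction_on with
  | _ k ih => exact (hX.forall_cond_unresolved_le_iff ih).1 (hM k)

end IsUniformPair

end Thresholds

/-! ### The dyadic code -/

lemma firstThresholdCode_eq {y : ℕ → ℝ} {q : ℝ × ℝ} {k : ℕ} (hk : Separates (y k) q)
    (hlt : ∀ j < k, ¬ Separates (y j) q) : firstThresholdCode y q = y k := by
  classical
  have hex : ∃ k, Separates (y k) q := ⟨k, hk⟩
  rw [firstThresholdCode, dif_pos hex]
  congr 1
  convert (Nat.find_eq_iff hex).2 ⟨hk, hlt⟩

lemma exists_first_separates {y : ℕ → ℝ} {q : ℝ × ℝ} (hex : ∃ k, Separates (y k) q) :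
    ∃ k, Separates (y k) q ∧ ∀ j < k, ¬ Separates (y j) q := by
  classical
  exact ⟨Nat.find hex, Nat.find_spec hex, fun j hj => Nat.find_min hex hj⟩

lemma measurable_firstThresholdCode (y : ℕ → ℝ) : Measurable (firstThresholdCode y) := by
  classical
  have hsep (k : ℕ) : MeasurableSet {q | Separates (y k) q} :=
    (measurableSet_le measurable_fst measurable_const).inter
      (measurableSet_lt measurable_const measurable_snd)
  have hex : MeasurableSet {q | ∃ k, Separates (y k) q} := by
    rw [Set.ofPred_exists]
    exact .iUnion hsep
  have hfind : Measurable fun q : {q | ∃ k, Separates (y k) q} => Nat.find q.2 :=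
    measurable_find (fun q : {q | ∃ k, Separates (y k) q} => q.2) fun k =>
      measurable_subtype_coe (hsep k)
  exact Measurable.dite (measurable_from_nat.comp hfind) (measurable_const (a := (0 : ℝ))) hex

lemma IsDyadicEnumeration.exists_separates {y : ℕ → ℝ} (hy : IsDyadicEnumeration y) {a b : ℝ}
    (ha : 0 ≤ a) (hab : a < b) (hb : b ≤ 1) : ∃ k, Separates (y k) (a, b) :=
  (hy.exists_mem_Ioo ha hab hb).imp fun _ hk => ⟨hk.1.le, hk.2⟩

lemma IsDyadicEnumeration.isCode_firstThresholdCode {Ω : Type*} [MeasurableSpace Ω]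
    {y : ℕ → ℝ} (hy : IsDyadicEnumeration y) (P : Measure Ω) (X : Fin 2 → Ω → ℝ) :
    IsCode P X (firstThresholdCode y) where
  measurable := measurable_firstThresholdCode y
  separates a b ha hab hb := by
    obtain ⟨k, hk, hlt⟩ := exists_first_separates (hy.exists_separates ha hab hb)
    rw [firstThresholdCode_eq hk hlt]
    exact hk
  discrete := by
    refine ⟨insert 0 (Set.range y), (Set.countable_range y).insert 0, .of_forall fun ω => ?_⟩
    rw [threshold, firstThresholdCode]
    split_ifs with h
    · exact .inr ⟨_, rfl⟩
    · exact .inl rfl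

/- The first threshold that separates the gains lies in the grid of the level at which the strategy
stops, and the midpoint of the current cell is the only point of that grid inside the cell. -/
lemma IsBisecting.fst_eq_firstThresholdCode {σ : Strategy} (hσ : IsBisecting σ) {y : ℕ → ℝ}
    (hy : IsDyadicEnumeration y) {x : Fin 2 → ℝ} (hx : ∀ i, x i ∈ Set.Ioc (0 : ℝ) 1) {n : ℕ}
    (hn : FirstSuccess σ x n) : (σ (history σ x n)).1 = firstThresholdCode y (ordered x) := by
  have hs := hn.success_notMem_history
  have hmid := (hσ _ hs).1
  have hidx := cellIndex_lt (history σ x n)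
  rw [length_history] at hmid hidx
  obtain ⟨hgrid, -⟩ := Finset.mem_sdiff.1 (mem_dyadicGrid_succ_sdiff.2 ⟨_, hidx, rfl⟩)
  rw [← hmid] at hgrid
  obtain ⟨m, hm, hym⟩ := dyadicGrid_subset_image (fun j _ => hy j) hgrid
  have hsep : Separates (y m) (ordered x) := hym ▸ hσ.separates hx hn
  obtain ⟨k, hk, hlt⟩ := exists_first_separates ⟨m, hsep⟩
  have hkm : k ≤ m := not_lt.1 fun h => hlt m h hsep
  rw [firstThresholdCode_eq hk hlt, hmid]
  exact (eq_of_mem_dyadicGrid_succ_of_separates (hσ.mem_Ioc_dyadic hx hs)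
    ((hy k).mem_dyadicGrid_of_lt (lt_of_le_of_lt hkm hm)) hk).symm

namespace IsUniformPair

variable {Ω : Type*} [MeasurableSpace Ω] {P : Measure Ω} {X : Fin 2 → Ω → ℝ}
  [IsProbabilityMeasure P] (hX : IsUniformPair P X) {y : ℕ → ℝ} (hy : IsDyadicEnumeration y)
include hX hy

lemma ae_exists_first_separates : ∀ᵐ ω ∂P, ∃ k, Separates (y k) (ordered fun i => X i ω) ∧
    ∀ j < k, ¬ Separates (y j) (ordered fun i => X i ω) := by
  filter_upwards [hX.ae_mem_Ioc, hX.ae_ne] with ω hω hne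
  exact exists_first_separates (hy.exists_separates (le_min (hω 0).1.le (hω 1).1.le)
    (min_lt_max.2 hne) (max_le (hω 0).2 (hω 1).2))

lemma real_threshold_firstThresholdCode (k : ℕ) :
    P.real (threshold X (firstThresholdCode y) ⁻¹' {y k}) =
      (2 ^ (2 * Nat.log 2 (k + 1) + 1))⁻¹ := by
  rw [← hX.real_unresolved_inter_separates (fun j _ => hy j) (hy k)]
  refine measureReal_congr ?_
  filter_upwards [hX.ae_exists_first_separates hy] with ω ⟨j, hj, hlt⟩
  refine propext ⟨fun h => ?_, fun h => firstThresholdCode_eq h.2 h.1⟩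
  obtain rfl : j = k := hy.injective ((firstThresholdCode_eq hj hlt).symm.trans h)
  exact ⟨hlt, hj⟩

lemma real_threshold_firstThresholdCode_eq_zero {t : ℝ} (ht : t ∉ Set.range y) :
    P.real (threshold X (firstThresholdCode y) ⁻¹' {t}) = 0 := by
  rw [measureReal_eq_zero_iff, measure_eq_zero_iff_ae_notMem]
  filter_upwards [hX.ae_exists_first_separates hy] with ω ⟨j, hj, hlt⟩ h
  exact ht ⟨j, (firstThresholdCode_eq hj hlt).symm.trans h⟩

theorem entropyBits_eq_three : entropyBits P (threshold X (firstThresholdCode y)) = 3 := by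
  have hsupp : Function.support (fun t : ℝ => ENNReal.ofReal
      (-(P.real (threshold X (firstThresholdCode y) ⁻¹' {t}) *
        Real.logb 2 (P.real (threshold X (firstThresholdCode y) ⁻¹' {t}))))) ⊆ Set.range y := by
    intro t ht
    by_contra hr
    exact ht (by simp [hX.real_threshold_firstThresholdCode_eq_zero hy hr])
  calc entropyBits P (threshold X (firstThresholdCode y))
      = ∑' k, ENNReal.ofReal (-((2 ^ (2 * Nat.log 2 (k + 1) + 1))⁻¹ *
          Real.logb 2 (2 ^ (2 * Nat.log 2 (k + 1) + 1))⁻¹)) := by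
        rw [entropyBits, ← hy.injective.tsum_eq hsupp]
        simp only [hX.real_threshold_firstThresholdCode hy]
    _ = ∑' k, ENNReal.ofReal
          ((2 * Nat.log 2 (k + 1) + 1) / 2 ^ (2 * Nat.log 2 (k + 1) + 1)) := by
        refine tsum_congr fun k => congrArg ENNReal.ofReal ?_
        rw [Real.logb_inv, Real.logb_pow, Real.logb_self_eq_one one_lt_two]
        push_cast
        ring
    _ = 3 := by
        rw [tsum_comp_log_succ fun n => ENNReal.ofReal ((2 * n + 1) / 2 ^ (2 * n + 1)),
          tsum_odd_mul_inv_two_pow]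

end IsUniformPair

/-! ### Every code has entropy at least three bits -/

section Surprise

variable {α : Type*} [MeasurableSpace α] {μ : Measure α}

lemma ae_real_singleton_pos [IsFiniteMeasure μ] {S : Set α} (hS : S.Countable)
    (hμ : ∀ᵐ x ∂μ, x ∈ S) : ∀ᵐ x ∂μ, 0 < μ.real {x} := by
  have hnull : ∀ᵐ x ∂μ, ∀ y ∈ S, μ.real {y} = 0 → x ≠ y := by
    refine (ae_ball_iff hS).2 fun y _ => ae_all_iff.2 fun hy => ?_
    exact measure_eq_zero_iff_ae_notMem.1 ((measureReal_eq_zero_iff (measure_ne_top _ _)).1 hy)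
  filter_upwards [hμ, hnull] with x hxS hx
  exact measureReal_nonneg.lt_of_ne' fun h0 => hx x hxS h0 rfl

variable [MeasurableSingletonClass α]

lemma finite_le_real_singleton [IsFiniteMeasure μ] {ε : ℝ} (hε : 0 < ε) :
    {x | ε ≤ μ.real {x}}.Finite := by
  refine (Measure.finite_const_le_meas_of_disjoint_iUnion μ (ENNReal.ofReal_pos.2 hε)
    measurableSet_singleton (fun x y hxy => Set.disjoint_singleton.2 hxy)
    (measure_ne_top _ _)).subset fun x hx => ?_
  exact (ENNReal.ofReal_le_iff_le_toReal (measure_ne_top _ _)).2 hx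

lemma measurable_real_singleton [IsFiniteMeasure μ] : Measurable fun x => μ.real {x} := by
  have hcount : {x | 0 ≠ μ.real {x}}.Countable := by
    refine (Set.countable_iUnion fun n : ℕ =>
      (finite_le_real_singleton (μ := μ) n.one_div_pos_of_nat).countable).mono fun x hx => ?_
    obtain ⟨n, hn⟩ := exists_nat_one_div_lt (measureReal_nonneg.lt_of_ne hx)
    exact Set.mem_iUnion.2 ⟨n, hn.le⟩
  exact measurable_const.measurable_of_countable_ne hcount

/-- The information content, in bits, of the outcome `x` of a random variable with law `μ`. -/
def surprise (μ : Measure α) (x : α) : ℝ≥0∞ := ENNReal.ofReal (-Real.logb 2 (μ.real {x}))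

lemma measurable_surprise [IsFiniteMeasure μ] : Measurable (surprise μ) :=
  ((Real.measurable_log.comp measurable_real_singleton).div_const _).neg.ennreal_ofReal

lemma lintegral_surprise_le_entropyBits {Ω : Type*} [MeasurableSpace Ω] {P : Measure Ω}
    [IsFiniteMeasure P] {Y : Ω → ℝ} {S : Set ℝ} (hY : Measurable Y) (hS : S.Countable)
    (hYS : ∀ᵐ ω ∂P, Y ω ∈ S) :
    ∫⁻ ω, surprise (P.map Y) (Y ω) ∂P ≤ entropyBits P Y := by
  have hterm (y : ℝ) : surprise (P.map Y) y * P.map Y {y} =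
      ENNReal.ofReal (-(P.real (Y ⁻¹' {y}) * Real.logb 2 (P.real (Y ⁻¹' {y})))) := by
    rw [surprise, ← ofReal_measureReal, mul_comm, ← ENNReal.ofReal_mul measureReal_nonneg, mul_neg,
      map_measureReal_apply hY (measurableSet_singleton y)]
  have hrestrict : (P.map Y).restrict S = P.map Y := Measure.restrict_eq_self_of_ae_mem
    ((ae_map_iff hY.aemeasurable hS.measurableSet).2 hYS)
  calc ∫⁻ ω, surprise (P.map Y) (Y ω) ∂P
    _ = ∫⁻ y in S, surprise (P.map Y) y ∂P.map Y := by
      rw [hrestrict, lintegral_map measurable_surprise hY]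
    _ = ∑' y : S, surprise (P.map Y) y * P.map Y {(y : ℝ)} := lintegral_countable _ hS
    _ ≤ entropyBits P Y := by
      simp only [hterm]
      exact ENNReal.tsum_comp_le_tsum_of_injective Subtype.val_injective _

end Surprise

lemma real_singleton_add_real_Ioo (μ : Measure ℝ) [IsFiniteMeasure μ] {l t u : ℝ} (hlt : l < t)
    (htu : t < u) : μ.real {t} + μ.real (Set.Ioo l t) + μ.real (Set.Ioo t u) =
      μ.real (Set.Ioo l u) := by
  rw [← measureReal_union (by simp) measurableSet_Ioo, Set.singleton_union,
    Set.Ioo_insert_right hlt, ← measureReal_union _ measurableSet_Ioo,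
    Set.Ioc_union_Ioo_eq_Ioo hlt.le htu]
  exact Set.disjoint_left.2 fun x hx hx' => hx.2.not_gt hx'.1

section Decomposition

variable {Ω : Type*} {X : Fin 2 → Ω → ℝ} {l t u : ℝ}

lemma disjoint_box_box : Disjoint (box X l t) (box X t u) :=
  Set.disjoint_left.2 fun _ h h' => (h 0).2.not_gt (h' 0).1

lemma disjoint_box_union_box_split :
    Disjoint (box X l t ∪ box X t u) (split X l t u) := by
  refine Set.disjoint_left.2 ?_
  rintro ω (h | h) ⟨-, hmin, hmax⟩
  · exact (max_le (h 0).2 (h 1).2).not_gt hmax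
  · exact (lt_min (h 0).1 (h 1).1).not_ge hmin

lemma box_union_box_subset_box (hlt : l ≤ t) (htu : t ≤ u) :
    box X l t ∪ box X t u ⊆ box X l u :=
  Set.union_subset (fun _ h i => Set.Ioc_subset_Ioc_right htu (h i))
    (fun _ h i => Set.Ioc_subset_Ioc_left hlt (h i))

variable [MeasurableSpace Ω] {P : Measure Ω}

lemma measurableSet_box (hX : ∀ i, Measurable (X i)) (l u : ℝ) : MeasurableSet (box X l u) := by
  rw [box_eq_inter]
  exact (hX 0 measurableSet_Ioc).inter (hX 1 measurableSet_Ioc)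

lemma measurableSet_split (hX : ∀ i, Measurable (X i)) (l t u : ℝ) :
    MeasurableSet (split X l t u) :=
  (measurableSet_box hX l u).inter (measurableSet_separates hX t)

lemma setLIntegral_box_add_box_add_split_le (hX : ∀ i, Measurable (X i)) (hlt : l ≤ t)
    (htu : t ≤ u) (f : Ω → ℝ≥0∞) :
    ∫⁻ ω in box X l t, f ω ∂P + ∫⁻ ω in box X t u, f ω ∂P + ∫⁻ ω in split X l t u, f ω ∂P ≤
      ∫⁻ ω in box X l u, f ω ∂P := by
  rw [← lintegral_union (measurableSet_box hX t u) disjoint_box_box,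
    ← lintegral_union (measurableSet_split hX l t u) disjoint_box_union_box_split]
  exact lintegral_mono_set
    (Set.union_subset (box_union_box_subset_box hlt htu) Set.inter_subset_left)

lemma real_box_inter_add_real_box_inter_le [IsFiniteMeasure P] (hX : ∀ i, Measurable (X i))
    (hlt : l ≤ t) (htu : t ≤ u) {A : Set Ω} (hA : MeasurableSet A) :
    P.real (box X l t ∩ A) + P.real (box X t u ∩ A) ≤ P.real (box X l u ∩ A) := by
  rw [← measureReal_union (disjoint_box_box.mono Set.inter_subset_left Set.inter_subset_left)
    ((measurableSet_box hX t u).inter hA), ← Set.union_inter_distrib_right]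
  exact measureReal_mono (Set.inter_subset_inter_left _ (box_union_box_subset_box hlt htu))

end Decomposition

section LowerBound

variable {Ω : Type*} [MeasurableSpace Ω] {P : Measure Ω} {X : Fin 2 → Ω → ℝ} {Y : Ω → ℝ}

/-- The event that the observed value of `Y` has probability less than `ε`. -/
def light (P : Measure Ω) (Y : Ω → ℝ) (ε : ℝ) : Set Ω := {ω | (P.map Y).real {Y ω} < ε}

lemma light_subset_light {δ ε : ℝ} (h : δ ≤ ε) : light P Y δ ⊆ light P Y ε :=
  fun _ hω => lt_of_lt_of_le hω h

/-- A lower bound for the contribution of `box X l u` to the expected surprise of `Y`: a box of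
area `(u - l) ^ 2` is worth three bits per unit of area more than the surprise of the event
`Y ∈ (l, u)`, apart from a correction for the values of `Y` of probability less than `ε`. -/
def budget (P : Measure Ω) (X : Fin 2 → Ω → ℝ) (Y : Ω → ℝ) (ε l u : ℝ) : ℝ :=
  (u - l) ^ 2 * (3 - Real.logb 2 ((P.map Y).real (Set.Ioo l u))) -
    3 * P.real (box X l u ∩ light P Y ε)

/-- The threshold variables of codes, up to null events: `Y` is discrete and almost surely
separates the two ordered gains. -/
structure IsDiscreteThreshold (P : Measure Ω) (X : Fin 2 → Ω → ℝ) (Y : Ω → ℝ) : Prop where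
  measurable : Measurable Y
  separates : ∀ᵐ ω ∂P, Separates (Y ω) (ordered fun i => X i ω)
  discrete : ∃ S : Set ℝ, S.Countable ∧ ∀ᵐ ω ∂P, Y ω ∈ S

lemma IsCode.isDiscreteThreshold [IsFiniteMeasure P] {C : ℝ × ℝ → ℝ} (hC : IsCode P X C)
    (hX : IsUniformPair P X) : IsDiscreteThreshold P X (threshold X C) where
  measurable := hC.measurable.comp (measurable_ordered hX.measurable)
  separates := by
    filter_upwards [hX.ae_mem_Ioc, hX.ae_ne] with ω hω hne
    exact hC.separates _ _ (lt_min (hω 0).1 (hω 1).1).le (min_lt_max.2 hne)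
      (max_le (hω 0).2 (hω 1).2)
  discrete := hC.discrete

namespace IsDiscreteThreshold

variable (hY : IsDiscreteThreshold P X Y)
include hY

lemma ae_mem_Ioo_of_mem_box (l u : ℝ) : ∀ᵐ ω ∂P, ω ∈ box X l u → Y ω ∈ Set.Ioo l u := by
  filter_upwards [hY.separates] with ω hω hbox
  exact ⟨(lt_min (hbox 0).1 (hbox 1).1).trans_le hω.1,
    hω.2.trans_le (max_le (hbox 0).2 (hbox 1).2)⟩

variable [IsProbabilityMeasure P]

lemma isProbabilityMeasure_map : IsProbabilityMeasure (P.map Y) :=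
  Measure.isProbabilityMeasure_map hY.measurable.aemeasurable

lemma ae_real_singleton_pos : ∀ᵐ ω ∂P, 0 < (P.map Y).real {Y ω} := by
  obtain ⟨S, hS, hYS⟩ := hY.discrete
  exact ae_of_ae_map hY.measurable.aemeasurable (Contention.ae_real_singleton_pos hS
    ((ae_map_iff hY.measurable.aemeasurable hS.measurableSet).2 hYS))

lemma measurableSet_light (ε : ℝ) : MeasurableSet (light P Y ε) :=
  measurableSet_lt (measurable_real_singleton.comp hY.measurable) measurable_const

lemma real_box_le_real_Ioo (l u : ℝ) : P.real (box X l u) ≤ (P.map Y).real (Set.Ioo l u) := by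
  rw [map_measureReal_apply hY.measurable measurableSet_Ioo]
  exact ENNReal.toReal_mono (measure_ne_top _ _)
    (measure_mono_ae (hY.ae_mem_Ioo_of_mem_box l u))

lemma setLIntegral_surprise_ge {E : Set Ω} (hE : MeasurableSet E) {m : ℝ} (hm1 : m ≤ 1)
    (hm : ∀ᵐ ω ∂P, ω ∈ E → (P.map Y).real {Y ω} ≤ m) :
    ENNReal.ofReal (P.real E * -Real.logb 2 m) ≤ ∫⁻ ω in E, surprise (P.map Y) (Y ω) ∂P := by
  by_cases hPE : P E = 0
  · simp [measureReal_def, hPE]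
  obtain ⟨ω, hω, hpos, hωm⟩ :=
    ((frequently_ae_mem_iff.2 hPE).and_eventually (hY.ae_real_singleton_pos.and hm)).exists
  have hm0 : 0 < m := hpos.trans_le (hωm hω)
  have hlog : 0 ≤ -Real.logb 2 m := neg_nonneg.2 (Real.logb_nonpos one_lt_two hm0.le hm1)
  rw [mul_comm, ENNReal.ofReal_mul hlog, ofReal_measureReal, ← setLIntegral_const]
  refine setLIntegral_mono_ae' hE ?_
  filter_upwards [hY.ae_real_singleton_pos, hm] with ω hpos hωm hω
  exact ENNReal.ofReal_le_ofReal
    (neg_le_neg (Real.logb_le_logb_of_le one_lt_two hpos (hωm hω)))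

lemma real_split_mul_neg_logb_le_setLIntegral_surprise (hX : ∀ i, Measurable (X i)) {l t u : ℝ}
    (ht : ∀ y ∈ Set.Ioo l u, (P.map Y).real {y} ≤ (P.map Y).real {t}) :
    ENNReal.ofReal (P.real (split X l t u) * -Real.logb 2 ((P.map Y).real {t})) ≤
      ∫⁻ ω in split X l t u, surprise (P.map Y) (Y ω) ∂P := by
  have := hY.isProbabilityMeasure_map
  refine hY.setLIntegral_surprise_ge (measurableSet_split hX l t u) measureReal_le_one ?_
  filter_upwards [hY.ae_mem_Ioo_of_mem_box l u] with ω hω h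
  exact ht _ (hω h.1)

variable (hX : IsUniformPair P X) {ε l t u : ℝ}
include hX

lemma real_Ioo_pos (hl : 0 ≤ l) (hlu : l < u) (hu : u ≤ 1) : 0 < (P.map Y).real (Set.Ioo l u) := by
  refine lt_of_lt_of_le ?_ (hY.real_box_le_real_Ioo l u)
  rw [hX.real_box hl hlu.le hu]
  exact pow_pos (sub_pos.2 hlu) 2

lemma budget_le_of_forall_lt (hl : 0 ≤ l) (hlu : l ≤ u) (hu : u ≤ 1)
    (hlight : ∀ y ∈ Set.Ioo l u, (P.map Y).real {y} < ε) :
    ENNReal.ofReal (budget P X Y ε l u) ≤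
      ∫⁻ ω in box X l u, surprise (P.map Y) (Y ω) ∂P := by
  have := hY.isProbabilityMeasure_map
  have hbox : P.real (box X l u ∩ light P Y ε) = P.real (box X l u) := by
    refine measureReal_congr ?_
    filter_upwards [hY.ae_mem_Ioo_of_mem_box l u] with ω hω
    exact propext (and_iff_left_of_imp fun h => hlight _ (hω h))
  have hbudget : budget P X Y ε l u =
      P.real (box X l u) * -Real.logb 2 ((P.map Y).real (Set.Ioo l u)) := by
    rw [budget, hbox, hX.real_box hl hlu hu]
    ring
  rw [hbudget]
  refine hY.setLIntegral_surprise_ge (measurableSet_box hX.measurable l u) measureReal_le_one ?_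
  filter_upwards [hY.ae_mem_Ioo_of_mem_box l u] with ω hω h
  exact measureReal_mono (Set.singleton_subset_iff.2 (hω h))

lemma budget_le_budget_add_budget_add (hl : 0 ≤ l) (hlt : l < t) (htu : t < u) (hu : u ≤ 1)
    (ht : 0 < (P.map Y).real {t}) :
    budget P X Y ε l u ≤ budget P X Y ε l t + budget P X Y ε t u +
      P.real (split X l t u) * -Real.logb 2 ((P.map Y).real {t}) := by
  have := hY.isProbabilityMeasure_map
  have hlogb := logb_split_le (sub_pos.2 hlt) (sub_pos.2 htu) ht
    (hY.real_Ioo_pos hX hl hlt (htu.le.trans hu)) (hY.real_Ioo_pos hX (hl.trans hlt.le) htu hu)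
    (real_singleton_add_real_Ioo (P.map Y) hlt htu).le
  have hlight := real_box_inter_add_real_box_inter_le (P := P) hX.measurable hlt.le htu.le
    (hY.measurableSet_light ε)
  rw [sub_add_sub_cancel'] at hlogb
  rw [hX.real_split hl hlt.le htu.le hu, budget, budget, budget]
  linarith

lemma budget_le_setLIntegral_surprise (hε : 0 < ε) (hl : 0 ≤ l) (hlu : l < u) (hu : u ≤ 1) :
    ENNReal.ofReal (budget P X Y ε l u) ≤
      ∫⁻ ω in box X l u, surprise (P.map Y) (Y ω) ∂P := by
  have := hY.isProbabilityMeasure_map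
  have hfin (l u : ℝ) : (Set.Ioo l u ∩ {y | ε ≤ (P.map Y).real {y}}).Finite :=
    (finite_le_real_singleton hε).subset Set.inter_subset_right
  induction hn : (Set.Ioo l u ∩ {y | ε ≤ (P.map Y).real {y}}).ncard using Nat.strong_induction_on
    generalizing l u with | _ n ih
  subst hn
  rcases (Set.Ioo l u ∩ {y | ε ≤ (P.map Y).real {y}}).eq_empty_or_nonempty with hempty | hne
  · refine hY.budget_le_of_forall_lt hX hl hlu.le hu fun y hy => ?_
    exact not_le.1 fun h => hempty.subset ⟨hy, h⟩
  -- Splitting at the heaviest atom `t`, the surprise on `split X l t u` is at least that of `t`.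
  obtain ⟨t, ⟨⟨hlt, htu⟩, htε⟩, hmax⟩ :=
    Set.exists_max_image _ (fun y => (P.map Y).real {y}) (hfin l u) hne
  have hheaviest (y : ℝ) (hy : y ∈ Set.Ioo l u) : (P.map Y).real {y} ≤ (P.map Y).real {t} :=
    (le_total ε _).elim (fun h => hmax y ⟨hy, h⟩) fun h => h.trans htε
  have hncard {a b : ℝ} (hla : l ≤ a) (hbu : b ≤ u) (ht : t ∉ Set.Ioo a b) :
      (Set.Ioo a b ∩ {y | ε ≤ (P.map Y).real {y}}).ncard <
        (Set.Ioo l u ∩ {y | ε ≤ (P.map Y).real {y}}).ncard := by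
    refine Set.ncard_lt_ncard ((Set.ssubset_iff_of_subset ?_).2
      ⟨t, ⟨⟨hlt, htu⟩, htε⟩, fun h => ht h.1⟩) (hfin l u)
    exact Set.inter_subset_inter_left _ (Set.Ioo_subset_Ioo hla hbu)
  have hleft := ih _ (hncard le_rfl htu.le fun h => h.2.false) hl hlt (htu.le.trans hu) rfl
  have hright := ih _ (hncard hlt.le le_rfl fun h => h.1.false) (hl.trans hlt.le) htu hu rfl
  have hsplit := hY.real_split_mul_neg_logb_le_setLIntegral_surprise hX.measurable hheaviest
  calc ENNReal.ofReal (budget P X Y ε l u)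
    _ ≤ ENNReal.ofReal (budget P X Y ε l t + budget P X Y ε t u +
          P.real (split X l t u) * -Real.logb 2 ((P.map Y).real {t})) :=
      ENNReal.ofReal_le_ofReal
        (hY.budget_le_budget_add_budget_add hX hl hlt htu hu (hε.trans_le htε))
    _ ≤ ENNReal.ofReal (budget P X Y ε l t) + ENNReal.ofReal (budget P X Y ε t u) +
        ENNReal.ofReal (P.real (split X l t u) * -Real.logb 2 ((P.map Y).real {t})) :=
      ENNReal.ofReal_add_le.trans (by gcongr; exact ENNReal.ofReal_add_le)
    _ ≤ _ := (add_le_add (add_le_add hleft hright) hsplit).trans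
      (setLIntegral_box_add_box_add_split_le hX.measurable hlt.le htu.le _)

omit hX in
lemma tendsto_real_light :
    Filter.Tendsto (fun n : ℕ => P.real (light P Y (1 / ((n : ℝ) + 1)))) Filter.atTop (nhds 0) := by
  have hanti : Antitone fun n : ℕ => light P Y (1 / ((n : ℝ) + 1)) :=
    fun m n hmn => light_subset_light (Nat.one_div_le_one_div hmn)
  have hnull : P (⋂ n : ℕ, light P Y (1 / ((n : ℝ) + 1))) = 0 := by
    rw [measure_eq_zero_iff_ae_notMem]
    filter_upwards [hY.ae_real_singleton_pos] with ω hpos hω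
    obtain ⟨n, hn⟩ := exists_nat_one_div_lt hpos
    exact hn.asymm (Set.mem_iInter.1 hω n)
  have hlim := tendsto_measure_iInter_atTop (μ := P)
    (fun n : ℕ => (hY.measurableSet_light (1 / ((n : ℝ) + 1))).nullMeasurableSet) hanti
    ⟨0, measure_ne_top _ _⟩
  rw [hnull] at hlim
  exact (ENNReal.tendsto_toReal ENNReal.zero_ne_top).comp hlim

lemma three_le_lintegral_surprise : 3 ≤ ∫⁻ ω, surprise (P.map Y) (Y ω) ∂P := by
  have := hY.isProbabilityMeasure_map
  have hlim : Filter.Tendsto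
      (fun n : ℕ => ENNReal.ofReal (3 - 3 * P.real (light P Y (1 / ((n : ℝ) + 1)))))
      Filter.atTop (nhds 3) := by
    simpa using ENNReal.tendsto_ofReal ((hY.tendsto_real_light.const_mul 3).const_sub 3)
  refine le_of_tendsto' hlim fun n => le_trans (ENNReal.ofReal_le_ofReal ?_)
    ((hY.budget_le_setLIntegral_surprise hX (n.one_div_pos_of_nat) le_rfl zero_lt_one
      le_rfl).trans (setLIntegral_le_lintegral _ _))
  have hlight : P.real (box X 0 1 ∩ light P Y (1 / ((n : ℝ) + 1))) ≤
      P.real (light P Y (1 / ((n : ℝ) + 1))) := measureReal_mono Set.inter_subset_right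
  have hlogb : Real.logb 2 ((P.map Y).real (Set.Ioo 0 1)) ≤ 0 :=
    Real.logb_nonpos one_lt_two measureReal_nonneg measureReal_le_one
  rw [budget]
  linarith

end IsDiscreteThreshold

lemma three_le_entropyBits_of_isCode [IsProbabilityMeasure P] (hX : IsUniformPair P X)
    {C : ℝ × ℝ → ℝ} (hC : IsCode P X C) : 3 ≤ entropyBits P (threshold X C) := by
  have hY := hC.isDiscreteThreshold hX
  obtain ⟨S, hS, hYS⟩ := hY.discrete
  exact (hY.three_le_lintegral_surprise hX).trans
    (lintegral_surprise_le_entropyBits hY.measurable hS hYS)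

end LowerBound
end Contention

end

theorem theorem2 {Ω : Type*} [MeasurableSpace Ω] (P : Measure Ω) [IsProbabilityMeasure P]
    (X : Fin 2 → Ω → ℝ) (hmeas : ∀ i, Measurable (X i))
    (hunif : ∀ i, pdf.IsUniform (X i) (Set.Icc (0 : ℝ) 1) P volume)
    (hindep : iIndepFun X P) :
    -- delay: the splitting algorithm is a maximal probability allocation strategy; every such
    -- strategy almost surely identifies the best user, with the minimal expected delay `2`
    (Contention.IsMPAStrategy P X (Contention.osa 2) ∧
      (∀ σ, Contention.IsMPAStrategy P X σ →
        (∀ᵐ ω ∂P, ∃ n, Contention.FirstSuccess σ (fun i => X i ω) n ∧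
          Contention.IdentifiesBest (σ (Contention.history σ (fun i => X i ω) n))
            (fun i => X i ω)) ∧
        Contention.expectedDelay P X σ = 2) ∧
      (∀ σ, 2 ≤ Contention.expectedDelay P X σ)) ∧
    -- entropy: maximal probability allocation gives the dyadic thresholds, and its code has the
    -- minimal entropy, `3` bits
    (Contention.IsMPAThresholds P X Contention.dyadicThreshold ∧
      (∀ y, Contention.IsMPAThresholds P X y →
        Set.range y = Set.range Contention.dyadicThreshold ∧
        Contention.IsCode P X (Contention.firstThresholdCode y) ∧
        Contention.entropyBits P
          (Contention.threshold X (Contention.firstThresholdCode y)) = 3) ∧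
      (∀ C, Contention.IsCode P X C →
        3 ≤ Contention.entropyBits P (Contention.threshold X C))) ∧
    -- it is the same scheme: the strategy stops at the threshold that the code assigns
    (∀ σ y, Contention.IsMPAStrategy P X σ → Contention.IsMPAThresholds P X y →
      ∀ᵐ ω ∂P, ∀ n, Contention.FirstSuccess σ (fun i => X i ω) n →
        (σ (Contention.history σ (fun i => X i ω) n)).1 =
          Contention.threshold X (Contention.firstThresholdCode y) ω) := by
  have hX := Contention.isUniformPair_of_iIndepFun hmeas hunif hindep
  simp only [hX.isMPAStrategy_iff, hX.isMPAThresholds_iff]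
  refine ⟨⟨Contention.isBisecting_osa_two,
      fun σ hσ => ⟨?_, hX.expectedDelay_eq_two hσ⟩,
      Contention.two_le_expectedDelay hX.measurable hX.indepFun hX.identDistrib⟩,
    ⟨Contention.isDyadicEnumeration_dyadicThreshold,
      fun y hy => ⟨?_, hy.isCode_firstThresholdCode P X, hX.entropyBits_eq_three hy⟩,
      fun C hC => Contention.three_le_entropyBits_of_isCode hX hC⟩,
    fun σ y hσ hy => ?_⟩
  · filter_upwards [hX.ae_mem_Ioc, hX.ae_ne] with ω hω hne
    obtain ⟨n, hn⟩ := hσ.exists_firstSuccess hω hne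
    exact ⟨n, hn, hσ.identifiesBest hω hn⟩
  · rw [hy.range_eq_iUnion, Contention.isDyadicEnumeration_dyadicThreshold.range_eq_iUnion]
  · filter_upwards [hX.ae_mem_Ioc] with ω hω n hn
    exact hσ.fst_eq_firstThresholdCode hy hω hn
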